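/- Call a compact convex subset of $\mathbb{R}^3$ with non-empty interior a convex body; let $\mathrm{Vol}$ denote volume and $\mathrm{Diam}$ the Euclidean diameter. (1) For every convex body $K\subset\mathbb{R}^3$ there is a linear bijection $T:\mathbb{R}^3\to\mathbb{R}^3$ such that $$\mathrm{Vol}(TK)\ \ge\ \frac{\sqrt2}{12}\,\mathrm{Diam}(TK)^3 .$$ (2) The bound is attained by simplices: if $K$ is the convex hull of four affinely independent points of $\mathbb{R}^3$, then $\mathrm{Vol}(TK)\le\frac{\sqrt2}{12}\,\mathrm{Diam}(TK)^3$ for every linear bijection $T:\mathbb{R}^3\to\mathbb{R}^3$, with equality for some such $T$. -/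

import Mathlib

/-- A convex body in `ℝ³`: a compact convex set with non-empty interior. -/
structure IsConvexBody3 (K : Set (EuclideanSpace ℝ (Fin 3))) : Prop where
  convex : Convex ℝ K
  isCompact : IsCompact K
  interior_nonempty : (interior K).Nonempty

/-! For the inequality, replace `K` by a linear image whose difference body `K - K` has maximal
volume among its linear images inside the unit ball. By the theorems of John and Carathéodory there
are six points `uᵢ` of `K - K` on the unit sphere and weights `cᵢ` with `∑ cᵢ uᵢ uᵢᵀ = I / 3`. If
`a` is the index of the largest weight, then `∑ⱼₖ cⱼ cₖ det(uₐ, uⱼ, uₖ)² = 2 / 9`; projecting along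
`uₐ` turns the determinants into those of five plane vectors, and a sharp estimate in the plane
gives `det(uₐ, uⱼ, uₖ)² ≥ 1 / 2` for some `j` and `k`. Since `K` contains translates of the three
segments `[0, uᵢ]` involved, its volume is at least `|det| / 6 ≥ √2 / 12`, while its diameter is at
most `1`.

The estimate in the plane says that five vectors, no two of which have a determinant exceeding `1`
in absolute value, have small energy. The energy is convex in each vector, so one may move the
vectors to the vertices of a square or of a pentagon whose diagonals have determinant `±1`.

For simplices, Hadamard's inequality for the parallelepiped circumscribed about a tetrahedron
bounds the volume, and the regular tetrahedron gives equality. -/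

open Matrix Topology

/-! ### Five vectors in the plane -/

/-- The determinant of two vectors of the plane. -/
def planeDet (p q : ℝ × ℝ) : ℝ := p.1 * q.2 - p.2 * q.1

theorem planeDet_self (p : ℝ × ℝ) : planeDet p p = 0 := by
  unfold planeDet; ring

theorem planeDet_swap_sq (p q : ℝ × ℝ) : planeDet p q ^ 2 = planeDet q p ^ 2 := by
  unfold planeDet; ring

theorem planeDet_pluecker (p q r s : ℝ × ℝ) :
    planeDet p q * planeDet r s + planeDet p s * planeDet q r = planeDet p r * planeDet q s := by
  unfold planeDet; ring

theorem sq_add_sq_add_sq_le_two_of_add_eq {x y z : ℝ} (h : x + y = z) (hx : x ^ 2 ≤ 1)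
    (hy : y ^ 2 ≤ 1) (hz : z ^ 2 ≤ 1) : x ^ 2 + y ^ 2 + z ^ 2 ≤ 2 := by
  subst h
  rcases le_total 0 (x * y) with hxy | hxy
  · linarith [add_sq x y]
  rcases le_total (x ^ 2) (y ^ 2) with h | h
  · nlinarith [hxy]
  · nlinarith [hxy]

theorem sq_add_sq_le_one_add_mul_sq {x y : ℝ} (hx : x ^ 2 ≤ 1) (hy : y ^ 2 ≤ 1) :
    x ^ 2 + y ^ 2 ≤ 1 + (x * y) ^ 2 := by
  nlinarith [mul_nonneg (sub_nonneg.2 hx) (sub_nonneg.2 hy)]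

theorem sum_planeDet_sq_four_le_five {p : Fin 4 → ℝ × ℝ}
    (hp : ∀ i j, planeDet (p i) (p j) ^ 2 ≤ 1) :
    planeDet (p 0) (p 1) ^ 2 + planeDet (p 0) (p 2) ^ 2 + planeDet (p 0) (p 3) ^ 2 +
      planeDet (p 1) (p 2) ^ 2 + planeDet (p 1) (p 3) ^ 2 + planeDet (p 2) (p 3) ^ 2 ≤ 5 := by
  have mul_sq_le (i j k l : Fin 4) :
      (planeDet (p i) (p j) * planeDet (p k) (p l)) ^ 2 ≤ 1 := by
    rw [mul_pow]
    exact mul_le_one₀ (hp i j) (sq_nonneg _) (hp k l)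
  have products := sq_add_sq_add_sq_le_two_of_add_eq
    (planeDet_pluecker (p 0) (p 1) (p 2) (p 3)) (mul_sq_le 0 1 2 3) (mul_sq_le 0 3 1 2)
    (mul_sq_le 0 2 1 3)
  linarith [sq_add_sq_le_one_add_mul_sq (hp 0 1) (hp 2 3),
    sq_add_sq_le_one_add_mul_sq (hp 0 3) (hp 1 2), sq_add_sq_le_one_add_mul_sq (hp 0 2) (hp 1 3)]

theorem convexOn_planeDet_sq (p : ℝ × ℝ) :
    ConvexOn ℝ Set.univ fun q ↦ planeDet p q ^ 2 := by
  refine ⟨convex_univ, fun x _ y _ a b ha hb hab ↦ ?_⟩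
  have linear : planeDet p (a • x + b • y) = a * planeDet p x + b * planeDet p y := by
    simp only [planeDet, Prod.fst_add, Prod.snd_add, Prod.smul_fst, Prod.smul_snd, smul_eq_mul]
    ring
  simp only [linear, smul_eq_mul]
  exact (even_two.convexOn_pow (𝕜 := ℝ)).2 trivial trivial ha hb hab

theorem convexOn_planeDet_update_sq {ι : Type*} [DecidableEq ι] (p : ι → ℝ × ℝ) (k i j : ι) :
    ConvexOn ℝ Set.univ fun q ↦
      planeDet (Function.update p k q i) (Function.update p k q j) ^ 2 := by
  by_cases hi : i = k <;> by_cases hj : j = k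
  · simpa only [hi, hj, planeDet_self] using convexOn_const _ convex_univ
  · simpa only [hi, Function.update_self, Function.update_of_ne hj, planeDet_swap_sq (p j)] using
      convexOn_planeDet_sq (p j)
  · simpa only [hj, Function.update_self, Function.update_of_ne hi] using convexOn_planeDet_sq (p i)
  · simpa only [Function.update_of_ne hi, Function.update_of_ne hj] using
      convexOn_const _ convex_univ

/-- The total weighted squared determinant of a finite family of vectors of the plane; every
unordered pair is counted twice. -/
def planeEnergy {ι : Type*} [Fintype ι] (w : ι → ℝ) (p : ι → ℝ × ℝ) : ℝ :=
  ∑ i, ∑ j, w i * w j * planeDet (p i) (p j) ^ 2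

section PlaneEnergy

variable {ι : Type*} [Fintype ι]

theorem planeEnergy_mono {w : ι → ℝ} (hw : ∀ i, 0 ≤ w i) {p q : ι → ℝ × ℝ}
    (h : ∀ i j, planeDet (p i) (p j) ^ 2 ≤ planeDet (q i) (q j) ^ 2) :
    planeEnergy w p ≤ planeEnergy w q :=
  Finset.sum_le_sum fun i _ ↦ Finset.sum_le_sum fun j _ ↦
    mul_le_mul_of_nonneg_left (h i j) (mul_nonneg (hw i) (hw j))

theorem planeEnergy_comp_perm (σ : Equiv.Perm ι) (w : ι → ℝ) (p : ι → ℝ × ℝ) :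
    planeEnergy (w ∘ σ) (p ∘ σ) = planeEnergy w p := by
  unfold planeEnergy
  rw [← Equiv.sum_comp σ fun i ↦ ∑ j, w i * w j * planeDet (p i) (p j) ^ 2]
  exact Finset.sum_congr rfl fun i _ ↦
    Equiv.sum_comp σ fun j ↦ w (σ i) * w j * planeDet (p (σ i)) (p j) ^ 2

theorem convexOn_planeEnergy_update [DecidableEq ι] {w : ι → ℝ} (hw : ∀ i, 0 ≤ w i)
    (p : ι → ℝ × ℝ) (k : ι) :
    ConvexOn ℝ Set.univ fun q ↦ planeEnergy w (Function.update p k q) := by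
  refine ⟨convex_univ, fun x _ y _ a b ha hb hab ↦ ?_⟩
  simp only [planeEnergy, smul_eq_mul, Finset.mul_sum, ← Finset.sum_add_distrib]
  refine Finset.sum_le_sum fun i _ ↦ Finset.sum_le_sum fun j _ ↦ ?_
  have term_le := (convexOn_planeDet_update_sq p k i j).2 (Set.mem_univ x) (Set.mem_univ y)
    ha hb hab
  have scaled := mul_le_mul_of_nonneg_left term_le (mul_nonneg (hw i) (hw j))
  simp only [smul_eq_mul] at scaled
  linarith

end PlaneEnergy

/-- Five non-negative masses that a sixth one, at least as large as each of them, completes to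
total mass `1`. -/
def IsSubdominant (w : Fin 5 → ℝ) : Prop :=
  ∀ i, 0 ≤ w i ∧ w i + ∑ j, w j ≤ 1

theorem IsSubdominant.comp_perm {w : Fin 5 → ℝ} (hw : IsSubdominant w)
    (σ : Equiv.Perm (Fin 5)) : IsSubdominant (w ∘ σ) := by
  intro i
  simpa only [Function.comp_apply, Equiv.sum_comp σ w] using hw (σ i)

theorem three_masses_le {m x y z : ℝ} (hm : 1 / 6 ≤ m) (hx : 0 ≤ x) (hy : 0 ≤ y) (hz : 0 ≤ z)
    (hxm : x ≤ m) (hs : x + y + z + m = 1) : x * y + x * z + y * z ≤ 2 / 9 := by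
  have balanced : x * y + x * z + y * z ≤ (1 - m - x) * (3 * x + (1 - m)) / 4 := by
    have : z = 1 - m - x - y := by linarith
    subst this
    nlinarith [sq_nonneg (2 * y - (1 - m - x))]
  rcases le_total m (1 / 4) with h | h
  · nlinarith [mul_nonneg (sub_nonneg.2 hxm) (by linarith : (0 : ℝ) ≤ 1 - 4 * m + (m - x)),
      mul_nonneg (sub_nonneg.2 hm) (by linarith : (0 : ℝ) ≤ m + 1 / 6),
      mul_nonneg (sub_nonneg.2 hxm) (sub_nonneg.2 hxm)]
  · nlinarith [sq_nonneg (3 * x - (1 - m)), mul_nonneg (sub_nonneg.2 h) (by linarith : 0 ≤ 1 - m)]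

theorem IsSubdominant.three_masses_le {w : Fin 5 → ℝ} (hw : IsSubdominant w) {k : Fin 5}
    {y z : ℝ} (hy : 0 ≤ y) (hz : 0 ≤ z) (hs : w k + y + z = ∑ i, w i) :
    w k * y + w k * z + y * z ≤ 2 / 9 := by
  have := hw k
  refine _root_.three_masses_le (m := 1 - ∑ i, w i) ?_ (hw k).1 hy hz ?_ ?_
  · have h0 := (hw 0).2
    have h1 := (hw 1).2
    have h2 := (hw 2).2
    have h3 := (hw 3).2
    have h4 := (hw 4).2
    simp only [Fin.sum_univ_five] at *
    linarith
  · linarith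
  · linarith

theorem sum_mul_le_of_sum_sub_le {ι : Type*} [Fintype ι] {b x : ι → ℝ} {B : ℝ}
    (hb : ∀ i, 0 ≤ b i) (hB : ∀ i, ∑ j, b j - b i ≤ B) (hx : ∀ i, x i ≤ 1)
    (hsum : ∑ i, x i + 1 ≤ Fintype.card ι) : ∑ i, b i * x i ≤ B := by
  rcases le_total (∑ j, b j) B with h | h
  · exact (Finset.sum_le_sum fun i _ ↦ mul_le_of_le_one_right (hb i) (hx i)).trans h
  have loss_le : ∑ i, (∑ j, b j - B) * (1 - x i) ≤ ∑ i, b i * (1 - x i) :=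
    Finset.sum_le_sum fun i _ ↦
      mul_le_mul_of_nonneg_right (by linarith [hB i]) (sub_nonneg.2 (hx i))
  simp only [← Finset.mul_sum, mul_sub, mul_one, Finset.sum_sub_distrib, Finset.sum_const,
    Finset.card_univ, nsmul_eq_mul] at loss_le
  nlinarith

theorem IsSubdominant.sum_four_mul_le {w : Fin 5 → ℝ} (hw : IsSubdominant w) {x : Fin 6 → ℝ}
    (hx : ∀ e, x e ≤ 1) (hsum : ∑ e, x e ≤ 5) :
    (w 0 + w 1) * w 2 * x 0 + (w 0 + w 1) * w 3 * x 1 + (w 0 + w 1) * w 4 * x 2 +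
      w 2 * w 3 * x 3 + w 2 * w 4 * x 4 + w 3 * w 4 * x 5 ≤ 2 / 9 := by
  have nonneg (i) : 0 ≤ w i := (hw i).1
  have total : ∑ i, w i = w 0 + w 1 + w 2 + w 3 + w 4 := Fin.sum_univ_five w
  have masses_le {k i j l n : Fin 5} (h : w k + w i + (w j + w l + w n) = ∑ i, w i) :=
    hw.three_masses_le (nonneg i) (add_nonneg (add_nonneg (nonneg j) (nonneg l)) (nonneg n)) h
  have masses_le' {k i j l n : Fin 5} (h : w k + (w i + w j) + (w l + w n) = ∑ i, w i) :=
    hw.three_masses_le (add_nonneg (nonneg i) (nonneg j)) (add_nonneg (nonneg l) (nonneg n)) h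
  suffices ∑ e, ![(w 0 + w 1) * w 2, (w 0 + w 1) * w 3, (w 0 + w 1) * w 4, w 2 * w 3, w 2 * w 4,
      w 3 * w 4] e * x e ≤ 2 / 9 by
    simpa only [Fin.sum_univ_six, Matrix.cons_val] using this
  refine sum_mul_le_of_sum_sub_le ?_ (fun e ↦ ?_) hx ?_
  · simp [Fin.forall_fin_succ, nonneg, mul_nonneg, add_nonneg]
  · fin_cases e <;>
      simp only [Fin.sum_univ_six, Fin.reduceFinMk, Fin.zero_eta, Fin.mk_one, Matrix.cons_val]
    · linarith [@masses_le 3 4 0 1 2 (by linarith)]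
    · linarith [@masses_le 2 4 0 1 3 (by linarith)]
    · linarith [@masses_le 2 3 0 1 4 (by linarith)]
    · linarith [@masses_le' 4 0 1 2 3 (by linarith)]
    · linarith [@masses_le' 3 0 1 2 4 (by linarith)]
    · linarith [@masses_le' 2 0 1 3 4 (by linarith)]
  · rw [Fintype.card_fin]
    push_cast
    linarith

theorem exists_perm_zero_one {i j : Fin 5} (hij : i ≠ j) :
    ∃ σ : Equiv.Perm (Fin 5), σ 0 = i ∧ σ 1 = j := by
  refine ⟨Equiv.swap 0 i * Equiv.swap 1 (Equiv.swap 0 i j), ?_⟩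
  revert i j
  decide

/-- A family of five plane vectors whose energy is at most `4 / 9` for all subdominant masses. -/
def EnergyBounded (p : Fin 5 → ℝ × ℝ) : Prop :=
  ∀ w, IsSubdominant w → planeEnergy w p ≤ 4 / 9

namespace EnergyBounded

theorem mono {p q : Fin 5 → ℝ × ℝ} (hq : EnergyBounded q)
    (h : ∀ i j, planeDet (p i) (p j) ^ 2 ≤ planeDet (q i) (q j) ^ 2) : EnergyBounded p :=
  fun w hw ↦ (planeEnergy_mono (fun i ↦ (hw i).1) h).trans (hq w hw)

theorem of_comp_perm {p : Fin 5 → ℝ × ℝ} {σ : Equiv.Perm (Fin 5)} (h : EnergyBounded (p ∘ σ)) :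
    EnergyBounded p := fun w hw ↦
  (planeEnergy_comp_perm σ w p).symm.le.trans (h (w ∘ σ) (hw.comp_perm σ))

theorem convex_update (p : Fin 5 → ℝ × ℝ) (k : Fin 5) :
    Convex ℝ {q | EnergyBounded (Function.update p k q)} := by
  have : {q | EnergyBounded (Function.update p k q)} = ⋂ (w) (_ : IsSubdominant w),
      {q ∈ Set.univ | planeEnergy w (Function.update p k q) ≤ 4 / 9} := by
    ext q
    simp [EnergyBounded]
  rw [this]
  exact convex_iInter₂ fun w hw ↦ (convexOn_planeEnergy_update (fun i ↦ (hw i).1) p k).convex_le _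

/- Equal vectors pool their masses, which leaves an estimate for four vectors. -/
theorem of_zero_eq_one {p : Fin 5 → ℝ × ℝ} (hp : ∀ i j, planeDet (p i) (p j) ^ 2 ≤ 1)
    (h01 : p 0 = p 1) : EnergyBounded p := by
  intro w hw
  have energy_le := hw.sum_four_mul_le
    (x := ![planeDet (p 1) (p 2) ^ 2, planeDet (p 1) (p 3) ^ 2, planeDet (p 1) (p 4) ^ 2,
      planeDet (p 2) (p 3) ^ 2, planeDet (p 2) (p 4) ^ 2, planeDet (p 3) (p 4) ^ 2])
    (by simp [Fin.forall_fin_succ, hp])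
    (by simpa [Fin.sum_univ_six] using
      sum_planeDet_sq_four_le_five (p := p ∘ Fin.succ) fun i j ↦ hp i.succ j.succ)
  simp only [Matrix.cons_val] at energy_le
  simp only [planeEnergy, Fin.sum_univ_five, h01, planeDet_self, planeDet_swap_sq (p 2) (p 1),
    planeDet_swap_sq (p 3) (p 1), planeDet_swap_sq (p 3) (p 2), planeDet_swap_sq (p 4) _]
  linarith

theorem of_eq {p : Fin 5 → ℝ × ℝ} (hp : ∀ i j, planeDet (p i) (p j) ^ 2 ≤ 1) {i j : Fin 5}
    (hij : i ≠ j) (h : p i = p j) : EnergyBounded p := by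
  obtain ⟨σ, rfl, rfl⟩ := exists_perm_zero_one hij
  exact of_comp_perm (of_zero_eq_one (p := p ∘ σ) (fun i j ↦ hp (σ i) (σ j)) h)

theorem comp {p : Fin 5 → ℝ × ℝ} (h : EnergyBounded p)
    (hp : ∀ i j, planeDet (p i) (p j) ^ 2 ≤ 1) (f : Fin 5 → Fin 5) : EnergyBounded (p ∘ f) := by
  by_cases hf : Function.Injective f
  · let σ := Equiv.ofBijective f hf.bijective_of_finite
    refine of_comp_perm (σ := σ.symm) (h.mono fun i j ↦ le_of_eq ?_)
    simp only [Function.comp_apply, σ, Equiv.ofBijective_apply_symm_apply]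
  · obtain ⟨i, j, hfij, hij⟩ := Function.not_injective_iff.1 hf
    exact of_eq (fun i j ↦ hp (f i) (f j)) hij (congrArg p hfij)

theorem of_forall_mem_insert_zero {v p : Fin 5 → ℝ × ℝ} (h : EnergyBounded v)
    (hv : ∀ i j, planeDet (v i) (v j) ^ 2 ≤ 1) (hp : ∀ i, p i ∈ insert 0 (Set.range v)) :
    EnergyBounded p := by
  have replace_zero (i) : ∃ k, p i = 0 ∨ p i = v k := by
    rcases hp i with h0 | ⟨k, hk⟩
    exacts [⟨0, .inl h0⟩, ⟨k, .inr hk.symm⟩]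
  choose f hf using replace_zero
  refine (h.comp hv f).mono fun i j ↦ ?_
  rcases hf i with hi | hi <;> rcases hf j with hj | hj <;> rw [hi, hj] <;>
    simp [planeDet, sq_nonneg]

theorem of_forall_mem_convexHull {v p : Fin 5 → ℝ × ℝ} (h : EnergyBounded v)
    (hv : ∀ i j, planeDet (v i) (v j) ^ 2 ≤ 1)
    (hp : ∀ i, p i ∈ convexHull ℝ (insert 0 (Set.range v))) : EnergyBounded p := by
  set V := insert 0 (Set.range v)
  suffices ∀ (s : Finset (Fin 5)) (q : Fin 5 → ℝ × ℝ), (∀ i ∈ s, q i ∈ convexHull ℝ V) →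
      (∀ i ∉ s, q i ∈ V) → EnergyBounded q from
    this Finset.univ p (fun i _ ↦ hp i) fun i hi ↦ absurd (Finset.mem_univ i) hi
  intro s
  induction s using Finset.induction_on with
  | empty => exact fun q _ hq ↦ h.of_forall_mem_insert_zero hv fun i ↦ hq i (Finset.notMem_empty i)
  | insert k s hk ih =>
    intro q hq hqV
    have vertex_mem : V ⊆ {x | EnergyBounded (Function.update q k x)} := by
      refine fun x hx ↦ ih _ (fun i hi ↦ ?_) fun i hi ↦ ?_
      · rw [Function.update_of_ne (ne_of_mem_of_not_mem hi hk)]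
        exact hq i (Finset.mem_insert_of_mem hi)
      · rcases eq_or_ne i k with rfl | hik
        · rwa [Function.update_self]
        · rw [Function.update_of_ne hik]
          exact hqV i fun hi' ↦ (Finset.mem_insert.1 hi').elim hik hi
    simpa only [Set.mem_ofPred_eq, Function.update_eq_self] using
      convexHull_min vertex_mem (convex_update q k) (hq k (Finset.mem_insert_self k s))

end EnergyBounded

theorem sum_sq_le_three_of_pentagon {s : Fin 5 → ℝ} (hs : ∀ i, s i ∈ Set.Icc 0 1)
    (h : ∀ i, s i * s (i + 2) + s (i + 1) = 1) : ∑ i, s i ^ 2 ≤ 3 := by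
  have h0 : s 0 = 1 - s 4 * s 1 := by linarith! [h 4]
  have h3 : s 3 = 1 - s 2 * s 4 := by linarith! [h 2]
  have sum_eq : s 1 + s 2 = 1 + s 1 * s 2 * s 4 := by
    have h1 : s 0 * s 2 + s 1 = 1 := h 0
    rw [h0] at h1
    linarith
  rw [Fin.sum_univ_five, h0, h3]
  obtain ⟨v0, v1⟩ := hs 4
  set v := s 4
  set P := s 1 * s 2 with hP
  have P0 : 0 ≤ P := mul_nonneg (hs 1).1 (hs 2).1
  have P1 : P ≤ 1 := mul_le_one₀ (hs 1).2 (hs 2).1 (hs 2).2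
  -- With `s 1 + s 2 = 1 + P v` the sum is a convex function of `P`, so only `P = 0` and `P = 1`
  -- matter.
  have expand : (1 - v * s 1) ^ 2 + s 1 ^ 2 + s 2 ^ 2 + (1 - s 2 * v) ^ 2 + v ^ 2 =
      2 + (1 + v ^ 2) * ((1 + P * v) ^ 2 - 2 * P) - 2 * v * (1 + P * v) + v ^ 2 := by
    rw [← sum_eq, hP]
    ring
  have at_zero : 3 - 2 * v * (1 - v) ≤ 3 := by nlinarith
  have at_one : v ^ 4 + 2 * v ^ 3 - v ^ 2 + 1 ≤ 3 := by
    nlinarith [mul_nonneg v0 v0, mul_nonneg (mul_nonneg v0 v0) v0,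
      mul_nonneg (mul_nonneg v0 v0) (sub_nonneg.2 v1)]
  calc _ = _ := expand
    _ ≤ (1 - P) * (3 - 2 * v * (1 - v)) + P * (v ^ 4 + 2 * v ^ 3 - v ^ 2 + 1) := by
      nlinarith [mul_nonneg (mul_nonneg P0 (sub_nonneg.2 P1))
        (by positivity : 0 ≤ (1 + v ^ 2) * v ^ 2)]
    _ ≤ 3 := by nlinarith

theorem sq_add_sq_one_sub_mul_add_sq_le {x y : ℝ} (hx : x ∈ Set.Icc (0 : ℝ) 1)
    (hy : y ∈ Set.Icc (0 : ℝ) 1) : x ^ 2 + (1 - x * y) ^ 2 + y ^ 2 ≤ 2 := by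
  obtain ⟨x0, x1⟩ := hx
  obtain ⟨y0, y1⟩ := hy
  nlinarith [mul_nonneg (mul_nonneg x0 y0) (sub_nonneg.2 (mul_le_one₀ x1 y0 y1)),
    mul_nonneg (by nlinarith : 0 ≤ 1 - x ^ 2) (by nlinarith : 0 ≤ 1 - y ^ 2)]

theorem le_sum_mul_of_zero_le {M : ℝ} {b l : Fin 5 → ℝ} (h0 : 0 ≤ b 0) (hmin : ∀ i, b 0 ≤ b i)
    (hb : ∀ i, M ≤ b i + b (i + 2)) (hl : ∀ i, 0 ≤ l i)
    (hl3 : ∀ i, 1 ≤ l i + l (i + 1) + l (i + 2)) (hl5 : 2 ≤ ∑ i, l i) :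
    M ≤ ∑ i, b i * l i := by
  have b20 : M ≤ b 0 + b 2 := hb 0
  have b30 : M ≤ b 3 + b 0 := hb 3
  have b41 : M ≤ b 4 + b 1 := hb 4
  have l123 : 1 ≤ l 1 + l 2 + l 3 := hl3 1
  have l234 : 1 ≤ l 2 + l 3 + l 4 := hl3 2
  have base := mul_le_mul_of_nonneg_left hl5 h0
  have excess (i) : 0 ≤ (b i - b 0) * l i := mul_nonneg (sub_nonneg.2 (hmin i)) (hl i)
  rw [Fin.sum_univ_five] at base ⊢
  rcases le_total M (2 * b 0) with h | h
  · linarith [excess 1, excess 2, excess 3, excess 4]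
  have gain2 := mul_nonneg (by linarith : 0 ≤ b 2 - b 0 - (M - 2 * b 0)) (hl 2)
  have gain3 := mul_nonneg (by linarith : 0 ≤ b 3 - b 0 - (M - 2 * b 0)) (hl 3)
  have gain14 := mul_nonneg (by linarith : 0 ≤ b 1 + b 4 - 2 * b 0 - (M - 2 * b 0))
    (le_min (hl 1) (hl 4))
  have loss := mul_nonneg (sub_nonneg.2 h)
    (by grind : 0 ≤ l 2 + l 3 + min (l 1) (l 4) - 1)
  have loss1 := mul_nonneg (sub_nonneg.2 (hmin 1)) (sub_nonneg.2 (min_le_left (l 1) (l 4)))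
  have loss4 := mul_nonneg (sub_nonneg.2 (hmin 4)) (sub_nonneg.2 (min_le_right (l 1) (l 4)))
  linarith

theorem le_sum_mul_of_five_cycle {M : ℝ} {b l : Fin 5 → ℝ} (h0 : ∀ i, 0 ≤ b i)
    (hb : ∀ i, M ≤ b i + b (i + 2)) (hl : ∀ i, 0 ≤ l i)
    (hl3 : ∀ i, 1 ≤ l i + l (i + 1) + l (i + 2)) (hl5 : 2 ≤ ∑ i, l i) :
    M ≤ ∑ i, b i * l i := by
  obtain ⟨k, hk⟩ := Finite.exists_min b
  rw [← Equiv.sum_comp (Equiv.addRight k)] at hl5 ⊢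
  refine le_sum_mul_of_zero_le (b := fun i ↦ b (i + k)) (l := fun i ↦ l (i + k)) (h0 _)
    (fun i ↦ by simpa using hk (i + k)) (fun i ↦ ?_) (fun i ↦ hl _) (fun i ↦ ?_) hl5
  · simpa only [add_right_comm] using hb (i + k)
  · simpa only [add_right_comm] using hl3 (i + k)

theorem IsSubdominant.sum_mul_sub_le {w : Fin 5 → ℝ} (hw : IsSubdominant w) (i : Fin 5) :
    ∑ j, w j * w (j + 1) + ∑ j, w j * w (j + 2) - 2 / 9 ≤
      w i * w (i + 1) + w (i + 2) * w (i + 2 + 1) := by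
  have total : w (i + 4) + (w i + w (i + 1)) + (w (i + 2) + w (i + 2 + 1)) = ∑ j, w j := by
    rw [Fin.sum_univ_five]
    fin_cases i <;>
      simp only [Fin.reduceFinMk, Fin.zero_eta, Fin.mk_one, Fin.reduceAdd, zero_add] <;> ring
  have pairs : ∑ j, w j * w (j + 1) + ∑ j, w j * w (j + 2) =
      w i * w (i + 1) + w (i + 2) * w (i + 2 + 1) + (w (i + 4) * (w i + w (i + 1)) +
        w (i + 4) * (w (i + 2) + w (i + 2 + 1)) +
        (w i + w (i + 1)) * (w (i + 2) + w (i + 2 + 1))) := by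
    simp only [Fin.sum_univ_five]
    fin_cases i <;>
      simp only [Fin.reduceFinMk, Fin.zero_eta, Fin.mk_one, Fin.reduceAdd, zero_add] <;> ring
  linarith [hw.three_masses_le (add_nonneg (hw i).1 (hw (i + 1)).1)
    (add_nonneg (hw (i + 2)).1 (hw (i + 2 + 1)).1) total]

theorem EnergyBounded.of_pentagon {p : Fin 5 → ℝ × ℝ} {s : Fin 5 → ℝ}
    (hs : ∀ i, s i ∈ Set.Icc 0 1) (h : ∀ i, s i * s (i + 2) + s (i + 1) = 1)
    (side : ∀ i, planeDet (p i) (p (i + 1)) ^ 2 = s i ^ 2)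
    (diagonal : ∀ i, planeDet (p i) (p (i + 2)) ^ 2 ≤ 1) : EnergyBounded p := by
  intro w hw
  have energy_eq : planeEnergy w p = 2 * (∑ i, w i * w (i + 1) * planeDet (p i) (p (i + 1)) ^ 2 +
      ∑ i, w i * w (i + 2) * planeDet (p i) (p (i + 2)) ^ 2) := by
    simp only [planeEnergy, Fin.sum_univ_five, Fin.reduceAdd, planeDet_self,
      planeDet_swap_sq (p 2) (p 1),
      planeDet_swap_sq (p 3) (p 1), planeDet_swap_sq (p 3) (p 2), planeDet_swap_sq (p 4) _,
      planeDet_swap_sq _ (p 0)]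
    ring
  have diagonals : ∑ i, w i * w (i + 2) * planeDet (p i) (p (i + 2)) ^ 2 ≤ ∑ i, w i * w (i + 2) :=
    Finset.sum_le_sum fun i _ ↦
      mul_le_of_le_one_right (mul_nonneg (hw i).1 (hw _).1) (diagonal i)
  have sides := le_sum_mul_of_five_cycle (b := fun i ↦ w i * w (i + 1)) (l := fun i ↦ 1 - s i ^ 2)
    (fun i ↦ mul_nonneg (hw i).1 (hw _).1) hw.sum_mul_sub_le (fun i ↦ ?_) (fun i ↦ ?_) ?_
  · simp only [mul_sub, mul_one, Finset.sum_sub_distrib] at sides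
    simp only [side] at energy_eq
    linarith
  · exact sub_nonneg.2 (pow_le_one₀ (hs i).1 (hs i).2)
  · have := sq_add_sq_one_sub_mul_add_sq_le (hs i) (hs (i + 2))
    rw [← h i, add_sub_cancel_left] at this
    linarith
  · have := sum_sq_le_three_of_pentagon hs h
    simp only [Finset.sum_sub_distrib, Finset.sum_const, Finset.card_univ, Fintype.card_fin,
      nsmul_eq_mul]
    push_cast
    linarith

theorem add_smul_mem_convexHull {E : Type*} [AddCommGroup E] [Module ℝ E] {s : Set E}
    {x y : E} {α β : ℝ} (h0 : 0 ∈ s) (hx : x ∈ s) (hy : y ∈ s) (hα : 0 ≤ α) (hβ : 0 ≤ β)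
    (hαβ : α + β ≤ 1) : α • x + β • y ∈ convexHull ℝ s := by
  have hs := subset_convexHull ℝ s
  have := (convex_convexHull ℝ s).sum_mem (t := Finset.univ) (w := ![1 - α - β, α, β])
    (z := ![0, x, y]) (by simp [Fin.forall_fin_succ, hα, hβ, le_sub_iff_add_le, add_comm, hαβ])
    (by rw [Fin.sum_univ_three]; simp only [Matrix.cons_val]; ring)
    (by simp [Fin.forall_fin_succ, hs h0, hs hx, hs hy])
  simpa [Fin.sum_univ_three] using this

theorem exists_mem_Icc_mul_eq {a b t : ℝ} (ht : 0 ≤ t) (ha : 0 ≤ a) (hb : 0 ≤ b)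
    (h : b ≤ t * a) : ∃ c ∈ Set.Icc 0 a, t * c = b :=
  ⟨b / t, ⟨div_nonneg hb ht, div_le_of_le_mul₀ ht ha (by linarith)⟩,
    mul_div_cancel_of_imp' fun h0 ↦ by subst h0; linarith⟩

theorem mem_convexHull_unit_pentagon {t u a b : ℝ} (ht : t ∈ Set.Icc 0 1)
    (hu : u ∈ Set.Icc 0 1) (ha : a ∈ Set.Icc 0 1) (hb : b ∈ Set.Icc 0 1)
    (hab : (1 - t) * a + (1 - u) * b ≤ 1 - t * u) {s : Set (ℝ × ℝ)} (h0 : 0 ∈ s)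
    (h1 : (1, 0) ∈ s) (h2 : (0, 1) ∈ s) (h3 : (1, t) ∈ s) (h4 : (u, 1) ∈ s) :
    (a, b) ∈ convexHull ℝ s := by
  rcases le_or_gt b (t * a) with hbt | hbt
  · obtain ⟨c, ⟨c0, ca⟩, rfl⟩ := exists_mem_Icc_mul_eq ht.1 ha.1 hb.1 hbt
    convert add_smul_mem_convexHull h0 h1 h3 (sub_nonneg.2 ca) c0 (by linarith [ha.2]) using 1
    ext <;> simp [mul_comm]
  rcases le_or_gt a (u * b) with hau | hau
  · obtain ⟨c, ⟨c0, cb⟩, rfl⟩ := exists_mem_Icc_mul_eq hu.1 hb.1 ha.1 hau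
    convert add_smul_mem_convexHull h0 h2 h4 (sub_nonneg.2 cb) c0 (by linarith [hb.2]) using 1
    ext <;> simp [mul_comm]
  have det_pos : 0 < 1 - t * u := by
    refine (sub_nonneg.2 (mul_le_one₀ ht.2 hu.1 hu.2)).lt_of_ne fun h ↦ ?_
    nlinarith [ht.2, hu.2, ht.1, hu.1]
  convert add_smul_mem_convexHull h0 h3 h4 (div_nonneg (sub_nonneg.2 hau.le) det_pos.le)
    (div_nonneg (sub_nonneg.2 hbt.le) det_pos.le) ?_ using 1
  · ext <;>
      simp only [Prod.fst_add, Prod.snd_add, Prod.smul_fst, Prod.smul_snd, smul_eq_mul, mul_one] <;>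
      rw [div_mul_eq_mul_div, ← add_div, eq_div_iff det_pos.ne'] <;> ring
  · rw [← add_div, div_le_one det_pos]
    linarith

theorem planeDet_abs_abs_sq {a b c d : ℝ} (h : 0 ≤ a * b * (c * d)) :
    planeDet (|a|, |b|) (|c|, |d|) ^ 2 = planeDet (a, b) (c, d) ^ 2 := by
  have abs_eq : |a| * |b| * (|c| * |d|) = a * b * (c * d) := by
    simp only [← abs_mul, abs_of_nonneg h]
  simp only [planeDet, sub_sq, mul_pow, sq_abs]
  linear_combination -2 * abs_eq

theorem planeDet_abs_neg_abs_sq {a b c d : ℝ} (h : a * b * (c * d) ≤ 0) :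
    planeDet (|a|, |b|) (|c|, -|d|) ^ 2 = planeDet (a, b) (c, d) ^ 2 := by
  have abs_eq : |a| * |b| * (|c| * |d|) = -(a * b * (c * d)) := by
    simp only [← abs_mul, abs_of_nonpos h]
  simp only [planeDet, sub_sq, mul_pow, neg_sq, sq_abs]
  linear_combination 2 * abs_eq

theorem planeDet_sq_le_one_of_unit_pentagon {t u : ℝ} {r : ℝ × ℝ} (ht : t ∈ Set.Icc 0 1)
    (hu : u ∈ Set.Icc 0 1) (h1 : planeDet (1, 0) r ^ 2 ≤ 1) (h2 : planeDet (0, 1) r ^ 2 ≤ 1)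
    (h3 : planeDet (1, t) r ^ 2 ≤ 1) (h4 : planeDet (u, 1) r ^ 2 ≤ 1) (i j : Fin 5) :
    planeDet (![(1, 0), (0, 1), (1, t), (u, 1), r] i)
      (![(1, 0), (0, 1), (1, t), (u, 1), r] j) ^ 2 ≤ 1 := by
  wlog hij : i < j generalizing i j
  · rcases (not_lt.1 hij).eq_or_lt with rfl | hji
    · rw [planeDet_self]
      norm_num
    · rw [planeDet_swap_sq]
      exact this j i hji
  have ht1 : |t| ≤ 1 := abs_le.2 ⟨by linarith [ht.1], ht.2⟩
  have hu1 : |u| ≤ 1 := abs_le.2 ⟨by linarith [hu.1], hu.2⟩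
  have htu : |1 - t * u| ≤ 1 := by
    rw [abs_of_nonneg (sub_nonneg.2 (mul_le_one₀ ht.2 hu.1 hu.2))]
    exact sub_le_self _ (mul_nonneg ht.1 hu.1)
  fin_cases i <;> fin_cases j <;> first
    | exact absurd hij (by decide)
    | assumption
    | norm_num [planeDet, ht1, hu1, htu]

theorem planeDet_sq_le_one_of_maximal_pentagon {t u e f : ℝ} (ht : t ∈ Set.Icc 0 1)
    (hu : u ∈ Set.Icc 0 1) (he : e ∈ Set.Icc 0 1) (hf : f ∈ Set.Icc 0 1) (h1 : t * e + f = 1)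
    (h2 : u * f + e = 1) (i j : Fin 5) :
    planeDet (![(1, 0), (0, 1), (1, t), (u, 1), (e, -f)] i)
      (![(1, 0), (0, 1), (1, t), (u, 1), (e, -f)] j) ^ 2 ≤ 1 := by
  have det3 : planeDet (1, t) (e, -f) = -1 := by
    simp only [planeDet]
    linarith
  have det4 : planeDet (u, 1) (e, -f) = -1 := by
    simp only [planeDet]
    linarith
  refine planeDet_sq_le_one_of_unit_pentagon ht hu ?_ ?_ (by norm_num [det3])
    (by norm_num [det4]) i j
  · simpa [planeDet] using abs_le.2 ⟨by linarith [hf.1], hf.2⟩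
  · simpa [planeDet] using abs_le.2 ⟨by linarith [he.1], he.2⟩

namespace EnergyBounded

theorem of_unit_pentagon {t u a b c d : ℝ} {r : ℝ × ℝ} (ht : t ∈ Set.Icc 0 1)
    (hu : u ∈ Set.Icc 0 1)
    (hv : ∀ i j, planeDet (![(1, 0), (0, 1), (1, t), (u, 1), r] i)
      (![(1, 0), (0, 1), (1, t), (u, 1), r] j) ^ 2 ≤ 1)
    (h : EnergyBounded ![(1, 0), (0, 1), (1, t), (u, 1), r])
    (ha : a ∈ Set.Icc 0 1) (hb : b ∈ Set.Icc 0 1) (hab : (1 - t) * a + (1 - u) * b ≤ 1 - t * u)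
    (hc : c ∈ Set.Icc 0 1) (hd : d ∈ Set.Icc 0 1) (hcd : (1 - t) * c + (1 - u) * d ≤ 1 - t * u) :
    EnergyBounded ![(1, 0), (0, 1), (a, b), (c, d), r] := by
  refine h.of_forall_mem_convexHull hv ?_
  set V := insert 0 (Set.range ![(1, 0), (0, 1), (1, t), (u, 1), r])
  have vertex (i) : ![(1, 0), (0, 1), (1, t), (u, 1), r] i ∈ V := .inr ⟨i, rfl⟩
  have hull {x y : ℝ} (hx : x ∈ Set.Icc 0 1) (hy : y ∈ Set.Icc 0 1)
      (hxy : (1 - t) * x + (1 - u) * y ≤ 1 - t * u) : (x, y) ∈ convexHull ℝ V :=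
    mem_convexHull_unit_pentagon ht hu hx hy hxy (.inl rfl) (vertex 0) (vertex 1) (vertex 2)
      (vertex 3)
  have hV := subset_convexHull ℝ V
  simp only [Fin.forall_fin_succ]
  exact ⟨hV (vertex 0), hV (vertex 1), hull ha hb hab, hull hc hd hcd, hV (vertex 4),
    fun i ↦ i.elim0⟩

theorem of_unit_square {a b c d : ℝ} {r : ℝ × ℝ} (ha : a ∈ Set.Icc 0 1) (hb : b ∈ Set.Icc 0 1)
    (hc : c ∈ Set.Icc 0 1) (hd : d ∈ Set.Icc 0 1) (h1 : planeDet (1, 0) r ^ 2 ≤ 1)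
    (h2 : planeDet (0, 1) r ^ 2 ≤ 1) (h3 : planeDet (1, 1) r ^ 2 ≤ 1) :
    EnergyBounded ![(1, 0), (0, 1), (a, b), (c, d), r] := by
  have one_mem : (1 : ℝ) ∈ Set.Icc 0 1 := ⟨zero_le_one, le_rfl⟩
  have hv := planeDet_sq_le_one_of_unit_pentagon one_mem one_mem h1 h2 h3 h3
  refine of_unit_pentagon one_mem one_mem hv (of_eq hv (i := 2) (j := 3) (by decide) rfl)
    ha hb ?_ hc hd ?_ <;> simp

theorem of_maximal_pentagon {t u e f : ℝ} (ht : t ∈ Set.Icc 0 1) (hu : u ∈ Set.Icc 0 1)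
    (he : e ∈ Set.Icc 0 1) (hf : f ∈ Set.Icc 0 1) (h1 : t * e + f = 1) (h2 : u * f + e = 1) :
    EnergyBounded ![(1, 0), (0, 1), (1, t), (u, 1), (e, -f)] := by
  have hv : 1 - t * u ∈ Set.Icc 0 1 :=
    ⟨sub_nonneg.2 (mul_le_one₀ ht.2 hu.1 hu.2), sub_le_self _ (mul_nonneg ht.1 hu.1)⟩
  -- In this cyclic order the determinants of vectors two steps apart are all `±1`.
  let σ : Equiv.Perm (Fin 5) := ⟨![2, 0, 4, 1, 3], ![1, 3, 0, 4, 2], by decide, by decide⟩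
  refine of_comp_perm (σ := σ) (of_pentagon (s := ![t, f, e, u, 1 - t * u])
    (Fin.forall_fin_succ.2 ?_) (fun i ↦ ?_) (fun i ↦ ?_) fun i ↦ ?_)
  · simpa only [Fin.forall_fin_succ] using ⟨ht, hf, he, hu, hv, fun i ↦ i.elim0⟩
  · fin_cases i
    · exact h1
    · change f * u + e = 1
      linarith
    · change e * (1 - t * u) + u = 1
      linear_combination h2 - u * h1
    · change u * t + (1 - t * u) = 1
      ring
    · change (1 - t * u) * f + t = 1
      linear_combination h1 - t * h2
  · fin_cases i
    · change (1 * 0 - t * 1) ^ 2 = t ^ 2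
      ring
    · change (1 * -f - 0 * e) ^ 2 = f ^ 2
      ring
    · change (e * 1 - -f * 0) ^ 2 = e ^ 2
      ring
    · change (0 * 1 - 1 * u) ^ 2 = u ^ 2
      ring
    · change (u * t - 1 * 1) ^ 2 = (1 - t * u) ^ 2
      ring
  · exact planeDet_sq_le_one_of_maximal_pentagon ht hu he hf h1 h2 _ _

/- If `e + f > 1`, the strip `|planeDet · (e, -f)| ≤ 1` cuts the unit square in the pentagon with
vertices `0`, `(1, 0)`, `(1, (1 - f) / e)`, `((1 - e) / f, 1)`, `(0, 1)`. -/
theorem of_opposite {a b c d e f : ℝ} (ha : a ∈ Set.Icc 0 1) (hb : b ∈ Set.Icc 0 1)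
    (hc : c ∈ Set.Icc 0 1) (hd : d ∈ Set.Icc 0 1) (he : e ∈ Set.Icc 0 1) (hf : f ∈ Set.Icc 0 1)
    (hab : planeDet (a, b) (e, -f) ^ 2 ≤ 1) (hcd : planeDet (c, d) (e, -f) ^ 2 ≤ 1) :
    EnergyBounded ![(1, 0), (0, 1), (a, b), (c, d), (e, -f)] := by
  rcases le_or_gt (e + f) 1 with hef | hef
  · refine of_unit_square ha hb hc hd ?_ ?_ ?_ <;> simp only [planeDet] <;> nlinarith [he.1, hf.1]
  have e0 : 0 < e := by linarith [hf.2]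
  have f0 : 0 < f := by linarith [he.2]
  have ht : (1 - f) / e ∈ Set.Icc 0 1 :=
    ⟨div_nonneg (sub_nonneg.2 hf.2) e0.le, (div_le_one e0).2 (by linarith)⟩
  have hu : (1 - e) / f ∈ Set.Icc 0 1 :=
    ⟨div_nonneg (sub_nonneg.2 he.2) f0.le, (div_le_one f0).2 (by linarith)⟩
  have below {x y : ℝ} (h : planeDet (x, y) (e, -f) ^ 2 ≤ 1) :
      (1 - (1 - f) / e) * x + (1 - (1 - e) / f) * y ≤ 1 - (1 - f) / e * ((1 - e) / f) := by
    have h : x * f + y * e ≤ 1 := by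
      have : x * f + y * e = -planeDet (x, y) (e, -f) := by
        simp only [planeDet]
        ring
      rw [this]
      exact (le_abs_self _).trans (by rwa [abs_neg, ← sq_le_one_iff_abs_le_one])
    have lhs_eq : (1 - (1 - f) / e) * x + (1 - (1 - e) / f) * y =
        (e + f - 1) / (e * f) * (x * f + y * e) := by
      field_simp
      ring
    have rhs_eq : 1 - (1 - f) / e * ((1 - e) / f) = (e + f - 1) / (e * f) := by
      field_simp
      ring
    rw [lhs_eq, rhs_eq]
    exact mul_le_of_le_one_right (div_nonneg (by linarith) (by positivity)) h
  have h1 : (1 - f) / e * e + f = 1 := by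
    field_simp
    ring
  have h2 : (1 - e) / f * f + e = 1 := by
    field_simp
    ring
  exact of_unit_pentagon ht hu (planeDet_sq_le_one_of_maximal_pentagon ht hu he hf h1 h2)
    (of_maximal_pentagon ht hu he hf h1 h2) ha hb (below hab) hc hd (below hcd)

end EnergyBounded

theorem mul_nonneg_or_mul_nonneg_or_mul_nonneg (x y z : ℝ) :
    0 ≤ x * y ∨ 0 ≤ x * z ∨ 0 ≤ y * z := by
  rcases le_total 0 x with hx | hx <;> rcases le_total 0 y with hy | hy <;>
    rcases le_total 0 z with hz | hz <;>
    simp [mul_nonneg, mul_nonneg_of_nonpos_of_nonpos, *]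

theorem same_sign_or_opposite_sign {x y : ℝ} (h : 0 ≤ x * y) (z : ℝ) :
    0 ≤ x * z ∧ 0 ≤ y * z ∨ x * z ≤ 0 ∧ y * z ≤ 0 := by
  rcases mul_nonneg_iff.1 h with ⟨hx, hy⟩ | ⟨hx, hy⟩ <;> rcases le_total 0 z with hz | hz <;>
    simp [mul_nonneg, mul_nonneg_of_nonpos_of_nonpos, mul_nonpos_of_nonneg_of_nonpos,
      mul_nonpos_of_nonpos_of_nonneg, *]

namespace EnergyBounded

theorem of_abs {a b c d e f g : ℝ}
    (hab : planeDet (|a|, |b|) (|c|, |d|) ^ 2 = planeDet (a, b) (c, d) ^ 2)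
    (hae : planeDet (|a|, |b|) (|e|, g) ^ 2 = planeDet (a, b) (e, f) ^ 2)
    (hce : planeDet (|c|, |d|) (|e|, g) ^ 2 = planeDet (c, d) (e, f) ^ 2)
    (hg : g ^ 2 = f ^ 2)
    (h : EnergyBounded ![(1, 0), (0, 1), (|a|, |b|), (|c|, |d|), (|e|, g)]) :
    EnergyBounded ![(1, 0), (0, 1), (a, b), (c, d), (e, f)] := by
  refine h.mono fun i j ↦ le_of_eq ?_
  wlog hij : i < j generalizing i j
  · rcases (not_lt.1 hij).eq_or_lt with rfl | hji
    · rw [planeDet_self, planeDet_self]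
    · rw [planeDet_swap_sq, this j i hji, planeDet_swap_sq]
  fin_cases i <;> fin_cases j <;> first
    | exact absurd hij (by decide)
    | exact hab.symm
    | exact hae.symm
    | exact hce.symm
    | simp [planeDet, hg]

/- Reflections in the coordinate axes move the three remaining vectors into one quadrant, or two of
them into one quadrant and the third into the adjacent one. -/
theorem of_mul_nonneg {a b c d e f : ℝ} (h : 0 ≤ a * b * (c * d))
    (hp : ∀ i j, planeDet (![(1, 0), (0, 1), (a, b), (c, d), (e, f)] i)
      (![(1, 0), (0, 1), (a, b), (c, d), (e, f)] j) ^ 2 ≤ 1) :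
    EnergyBounded ![(1, 0), (0, 1), (a, b), (c, d), (e, f)] := by
  have abs_mem {x y : ℝ} (h0 : planeDet (1, 0) (x, y) ^ 2 ≤ 1)
      (h1 : planeDet (0, 1) (x, y) ^ 2 ≤ 1) : |x| ∈ Set.Icc 0 1 ∧ |y| ∈ Set.Icc 0 1 := by
    simp_all [planeDet]
  obtain ⟨ha, hb⟩ := abs_mem (hp 0 2) (hp 1 2)
  obtain ⟨hc, hd⟩ := abs_mem (hp 0 3) (hp 1 3)
  obtain ⟨he, hf⟩ := abs_mem (hp 0 4) (hp 1 4)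
  have hab := planeDet_abs_abs_sq h
  rcases same_sign_or_opposite_sign h (e * f) with ⟨hae, hce⟩ | ⟨hae, hce⟩
  · refine of_abs hab (planeDet_abs_abs_sq hae) (planeDet_abs_abs_sq hce) (sq_abs f)
      (of_unit_square ha hb hc hd ?_ ?_ ?_) <;>
      simp only [planeDet] <;> nlinarith [he.1, he.2, hf.1, hf.2]
  · have hae' := planeDet_abs_neg_abs_sq hae
    have hce' := planeDet_abs_neg_abs_sq hce
    refine of_abs hab hae' hce' (by rw [neg_sq, sq_abs])
      (of_opposite ha hb hc hd he hf (hae'.trans_le ?_) (hce'.trans_le ?_))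
    exacts [hp 2 4, hp 3 4]

theorem of_standard {p : Fin 5 → ℝ × ℝ} (hp : ∀ i j, planeDet (p i) (p j) ^ 2 ≤ 1)
    (h0 : p 0 = (1, 0)) (h1 : p 1 = (0, 1)) : EnergyBounded p := by
  have of_perm (σ : Equiv.Perm (Fin 5)) (hσ0 : σ 0 = 0) (hσ1 : σ 1 = 1)
      (h : 0 ≤ (p (σ 2)).1 * (p (σ 2)).2 * ((p (σ 3)).1 * (p (σ 3)).2)) : EnergyBounded p := by
    have eq : p ∘ σ = ![(1, 0), (0, 1), ((p (σ 2)).1, (p (σ 2)).2), ((p (σ 3)).1, (p (σ 3)).2),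
        ((p (σ 4)).1, (p (σ 4)).2)] := by
      funext i
      fin_cases i <;> simp [hσ0, hσ1, h0, h1]
    refine .of_comp_perm (σ := σ) (eq ▸ of_mul_nonneg h fun i j ↦ ?_)
    rw [← eq]
    exact hp _ _
  rcases mul_nonneg_or_mul_nonneg_or_mul_nonneg ((p 2).1 * (p 2).2) ((p 3).1 * (p 3).2)
    ((p 4).1 * (p 4).2) with h | h | h
  · exact of_perm 1 rfl rfl h
  · exact of_perm (Equiv.swap 3 4) rfl rfl h
  · exact of_perm (Equiv.swap 2 4) rfl rfl (by rwa [mul_comm])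

end EnergyBounded

theorem IsSubdominant.exists_planeEnergy_le {w : Fin 5 → ℝ} (hw : IsSubdominant w)
    (p : Fin 5 → ℝ × ℝ) : ∃ i j, planeEnergy w p ≤ 4 / 9 * planeDet (p i) (p j) ^ 2 := by
  obtain ⟨⟨j, k⟩, hmax⟩ := Finite.exists_max fun ij : Fin 5 × Fin 5 ↦
    planeDet (p ij.1) (p ij.2) ^ 2
  refine ⟨j, k, ?_⟩
  set D := planeDet (p j) (p k) with hD
  replace hmax (i i' : Fin 5) : planeDet (p i) (p i') ^ 2 ≤ D ^ 2 := hmax (i, i')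
  rcases eq_or_ne D 0 with hD0 | hD0
  · have zero (i i' : Fin 5) : planeDet (p i) (p i') ^ 2 = 0 :=
      le_antisymm (by simpa [hD0] using hmax i i') (sq_nonneg _)
    simp [planeEnergy, zero, sq_nonneg]
  have hjk : j ≠ k := by
    rintro rfl
    exact hD0 (planeDet_self _)
  let q (i : Fin 5) : ℝ × ℝ := (planeDet (p i) (p k) / D, planeDet (p j) (p i) / D)
  have planeDet_q (i i' : Fin 5) :
      planeDet (q i) (q i') ^ 2 = planeDet (p i) (p i') ^ 2 / D ^ 2 := by
    rw [← div_pow]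
    congr 1
    rw [eq_div_iff hD0]
    simp only [planeDet, q]
    field_simp
    rw [hD]
    simp only [planeDet]
    ring
  have hq : EnergyBounded q := by
    obtain ⟨σ, h0, h1⟩ := exists_perm_zero_one hjk
    refine .of_comp_perm (σ := σ) (.of_standard (fun i i' ↦ ?_) ?_ ?_)
    · rw [Function.comp_apply, Function.comp_apply, planeDet_q, div_le_one (by positivity)]
      exact hmax _ _
    · simp [q, h0, planeDet_self, ← hD, hD0]
    · simp [q, h1, planeDet_self, ← hD, hD0]
  have scale : planeEnergy w q = planeEnergy w p / D ^ 2 := by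
    simp only [planeEnergy, planeDet_q, Finset.sum_div, mul_div_assoc]
  have := hq w hw
  rwa [scale, div_le_iff₀ (by positivity)] at this

/-! ### Contact points of a body in John position -/

section Caratheodory

variable {E : Type*} [AddCommGroup E] [Module ℝ E] [FiniteDimensional ℝ E] {s : Set E}

theorem mem_convexHull_iff_exists_fin {n : ℕ} (hn : Module.finrank ℝ (vectorSpan ℝ s) < n)
    {x : E} : x ∈ convexHull ℝ s ↔
      ∃ c ∈ stdSimplex ℝ (Fin n), ∃ z : Fin n → E, (∀ i, z i ∈ s) ∧ ∑ i, c i • z i = x := by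
  refine ⟨fun hx ↦ ?_, ?_⟩
  · obtain ⟨ι, _, z, w, hz, hind, hw, hw1, hsum⟩ := eq_pos_convex_span_of_mem_convexHull hx
    have card_le : Fintype.card ι ≤ Fintype.card (Fin n) := by
      rw [Fintype.card_fin]
      exact hind.card_le_finrank_succ.trans
        ((Nat.succ_le_succ (Submodule.finrank_mono (vectorSpan_mono ℝ hz))).trans hn)
    obtain ⟨e⟩ := Function.Embedding.nonempty_of_card_le card_le
    obtain ⟨y, hy⟩ := convexHull_nonempty_iff.1 ⟨x, hx⟩
    have extend_zero {i} (hi : i ∉ Set.range e) : Function.extend e w 0 i = 0 :=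
      Function.extend_apply' _ _ _ hi
    refine ⟨Function.extend e w 0, ⟨fun i ↦ ?_, ?_⟩, Function.extend e z fun _ ↦ y, fun i ↦ ?_, ?_⟩
    · by_cases hi : i ∈ Set.range e
      · obtain ⟨i, rfl⟩ := hi
        rw [e.injective.extend_apply]
        exact (hw i).le
      · rw [extend_zero hi]
    · rw [← hw1]
      exact (Fintype.sum_of_injective e e.injective _ _ (fun _ ↦ extend_zero)
        fun i ↦ (e.injective.extend_apply w 0 i).symm).symm
    · by_cases hi : i ∈ Set.range e
      · obtain ⟨i, rfl⟩ := hi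
        rw [e.injective.extend_apply]
        exact hz ⟨i, rfl⟩
      · rwa [Function.extend_apply' _ _ _ hi]
    · rw [← hsum]
      exact (Fintype.sum_of_injective e e.injective _ _
        (fun i hi ↦ by rw [extend_zero hi, zero_smul])
        fun i ↦ by rw [e.injective.extend_apply, e.injective.extend_apply]).symm
  · rintro ⟨c, hc, z, hz, rfl⟩
    exact (convex_convexHull ℝ s).sum_mem (fun i _ ↦ hc.1 i) hc.2
      fun i _ ↦ subset_convexHull ℝ s (hz i)

theorem isCompact_convexHull_of_isCompact [TopologicalSpace E] [ContinuousAdd E]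
    [ContinuousSMul ℝ E] (hs : IsCompact s) : IsCompact (convexHull ℝ s) := by
  have hull_eq : convexHull ℝ s =
      (fun p : (Fin (Module.finrank ℝ (vectorSpan ℝ s) + 1) → ℝ) × (Fin _ → E) ↦
        ∑ i, p.1 i • p.2 i) '' (stdSimplex ℝ _ ×ˢ Set.univ.pi fun _ ↦ s) := by
    ext x
    rw [mem_convexHull_iff_exists_fin (Nat.lt_succ_self _)]
    constructor
    · rintro ⟨c, hc, z, hz, rfl⟩
      exact ⟨(c, z), ⟨hc, fun i _ ↦ hz i⟩, rfl⟩
    · rintro ⟨⟨c, z⟩, ⟨hc, hz⟩, rfl⟩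
      exact ⟨c, hc, z, fun i ↦ hz i trivial, rfl⟩
  rw [hull_eq]
  exact ((isCompact_stdSimplex ℝ _).prod (isCompact_univ_pi fun _ ↦ hs)).image (by fun_prop)

end Caratheodory

section John

variable {n : Type*} [Fintype n] [DecidableEq n]

theorem one_add_smul_mulVec_dotProduct_self (H : Matrix n n ℝ) (ε : ℝ) (s : n → ℝ) :
    ((1 + ε • H) *ᵥ s) ⬝ᵥ ((1 + ε • H) *ᵥ s) =
      s ⬝ᵥ s + ε * (2 * (s ⬝ᵥ H *ᵥ s) + ε * (H *ᵥ s ⬝ᵥ H *ᵥ s)) := by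
  simp only [add_mulVec, one_mulVec, smul_mulVec, dotProduct_add, add_dotProduct, dotProduct_smul,
    smul_dotProduct, smul_eq_mul, dotProduct_comm (H *ᵥ s) s]
  ring

theorem eventually_one_lt_det_one_add_smul {H : Matrix n n ℝ} (hH : 0 < H.trace) :
    ∀ᶠ ε : ℝ in 𝓝[>] 0, 1 < (1 + ε • H).det := by
  set P := (det (1 + (Polynomial.X : Polynomial ℝ) • H.map Polynomial.C)).divX.divX
  have continuous : Continuous fun ε ↦ H.trace + P.eval ε * ε := by fun_prop
  have slope_pos : ∀ᶠ ε in 𝓝 0, 0 < H.trace + P.eval ε * ε :=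
    continuous.continuousAt.eventually_const_lt (by simpa using hH)
  filter_upwards [slope_pos.filter_mono nhdsWithin_le_nhds, self_mem_nhdsWithin] with ε h hε
  rw [det_one_add_smul]
  linarith [mul_pos hε h]

theorem eventually_one_add_smul_mulVec_le_one {S : Set (n → ℝ)} (hS : IsCompact S)
    (hS1 : ∀ s ∈ S, s ⬝ᵥ s ≤ 1) {H : Matrix n n ℝ}
    (hH : ∀ s ∈ S, s ⬝ᵥ s = 1 → s ⬝ᵥ H *ᵥ s < 0) :
    ∀ᶠ ε : ℝ in 𝓝[>] 0, ∀ s ∈ S, ((1 + ε • H) *ᵥ s) ⬝ᵥ ((1 + ε • H) *ᵥ s) ≤ 1 := by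
  suffices ∀ᶠ ε : ℝ in 𝓝 0, ∀ s ∈ S,
      0 < ε → s ∈ S → ((1 + ε • H) *ᵥ s) ⬝ᵥ ((1 + ε • H) *ᵥ s) ≤ 1 by
    filter_upwards [this.filter_mono nhdsWithin_le_nhds, self_mem_nhdsWithin] with ε h hε s hs
    exact h s hs hε hs
  refine hS.eventually_forall_of_forall_eventually fun s hs ↦ ?_
  rcases (hS1 s hs).lt_or_eq with hs1 | hs1
  · have continuous : Continuous fun z : ℝ × (n → ℝ) ↦
        ((1 + z.1 • H) *ᵥ z.2) ⬝ᵥ ((1 + z.1 • H) *ᵥ z.2) := by fun_prop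
    filter_upwards [continuous.continuousAt.eventually_lt_const (u := 1) (by simpa using hs1)]
      with z hz _ _ using hz.le
  · have continuous : Continuous fun z : ℝ × (n → ℝ) ↦
        2 * (z.2 ⬝ᵥ H *ᵥ z.2) + z.1 * (H *ᵥ z.2 ⬝ᵥ H *ᵥ z.2) := by fun_prop
    filter_upwards [continuous.continuousAt.eventually_lt_const (u := 0)
      (by simpa using mul_neg_of_pos_of_neg two_pos (hH s hs hs1))] with z hz hε hzS
    rw [one_add_smul_mulVec_dotProduct_self]
    linarith [hS1 _ hzS, mul_neg_of_pos_of_neg hε hz]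

theorem exists_one_lt_det {S : Set (n → ℝ)} (hS : IsCompact S)
    (hS1 : ∀ s ∈ S, s ⬝ᵥ s ≤ 1) {H : Matrix n n ℝ} (htr : 0 < H.trace)
    (hH : ∀ s ∈ S, s ⬝ᵥ s = 1 → s ⬝ᵥ H *ᵥ s < 0) :
    ∃ R : Matrix n n ℝ, 1 < R.det ∧ ∀ s ∈ S, R *ᵥ s ⬝ᵥ R *ᵥ s ≤ 1 := by
  obtain ⟨ε, hdet, hε⟩ := ((eventually_one_lt_det_one_add_smul htr).and
    (eventually_one_add_smul_mulVec_le_one hS hS1 hH)).exists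
  exact ⟨1 + ε • H, hdet, hε⟩

theorem exists_matrix_dotProduct_mulVec_eq (f : Matrix n n ℝ →ₗ[ℝ] ℝ) :
    ∃ H : Matrix n n ℝ, (∀ s, f (vecMulVec s s) = s ⬝ᵥ H *ᵥ s) ∧ f 1 = H.trace := by
  have apply_eq (A : Matrix n n ℝ) : f A = ∑ i, ∑ j, A i j * f (single i j 1) := by
    conv_lhs => rw [matrix_eq_sum_single A]
    simp only [map_sum]
    refine Finset.sum_congr rfl fun i _ ↦ Finset.sum_congr rfl fun j _ ↦ ?_
    rw [← smul_eq_mul, ← map_smul, smul_single, smul_eq_mul, mul_one]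
  refine ⟨of fun i j ↦ f (single i j 1), fun s ↦ ?_, ?_⟩
  · simp only [apply_eq (vecMulVec s s), vecMulVec_apply, dotProduct, mulVec, of_apply,
      Finset.mul_sum]
    refine Finset.sum_congr rfl fun i _ ↦ Finset.sum_congr rfl fun j _ ↦ ?_
    ring
  · simp [apply_eq 1, one_apply, trace]

theorem inv_card_smul_one_mem_convexHull [Nonempty n] {S : Set (n → ℝ)} (hS : IsCompact S)
    (hS1 : ∀ s ∈ S, s ⬝ᵥ s ≤ 1)
    (hmax : ∀ R : Matrix n n ℝ, (∀ s ∈ S, R *ᵥ s ⬝ᵥ R *ᵥ s ≤ 1) → R.det ≤ 1) :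
    ((Fintype.card n : ℝ)⁻¹ • 1 : Matrix n n ℝ) ∈
      convexHull ℝ ((fun s ↦ vecMulVec s s) '' {s ∈ S | s ⬝ᵥ s = 1}) := by
  by_contra hmem
  have contact_compact : IsCompact {s ∈ S | s ⬝ᵥ s = 1} :=
    hS.inter_right (isClosed_eq (by fun_prop) continuous_const)
  have : LocallyConvexSpace ℝ (Matrix n n ℝ) := inferInstanceAs (LocallyConvexSpace ℝ (n → n → ℝ))
  obtain ⟨f, g, hg1, hg⟩ := geometric_hahn_banach_point_closed (convex_convexHull ℝ _)
    (isCompact_convexHull_of_isCompact (contact_compact.image (by fun_prop))).isClosed hmem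
  obtain ⟨H, hH, htr⟩ := exists_matrix_dotProduct_mulVec_eq f.toLinearMap
  have card_pos : (0 : ℝ) < Fintype.card n := by exact_mod_cast Fintype.card_pos
  have trace_pos : 0 < (g • 1 - H).trace := by
    rw [map_smul, smul_eq_mul, inv_mul_lt_iff₀ card_pos] at hg1
    rw [trace_sub, trace_smul, trace_one, smul_eq_mul, ← htr]
    simpa [mul_comm] using hg1
  obtain ⟨R, hR, hRS⟩ := exists_one_lt_det hS hS1 trace_pos fun s hs hs1 ↦ by
    have lt_apply := hg _ (subset_convexHull ℝ _ ⟨s, ⟨hs, hs1⟩, rfl⟩)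
    rw [sub_mulVec, smul_mulVec, one_mulVec, dotProduct_sub, dotProduct_smul, hs1, ← hH]
    simpa using lt_apply
  exact (hmax R hRS).not_gt hR

end John

/-- A weighted system of unit vectors which decomposes a multiple of the identity, as the contact
points in John's theorem do. The weights are normalised to have sum `1`. -/
structure IsIsotropic {ι n : Type*} [Fintype ι] [Fintype n] [DecidableEq n] (c : ι → ℝ)
    (u : ι → n → ℝ) : Prop where
  nonneg : ∀ i, 0 ≤ c i
  dotProduct_self : ∀ i, u i ⬝ᵥ u i = 1
  sum_smul_vecMulVec : ∑ i, c i • vecMulVec (u i) (u i) = (Fintype.card n : ℝ)⁻¹ • 1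

namespace IsIsotropic

section General

variable {ι n : Type*} [Fintype ι] [Fintype n] [DecidableEq n] {c : ι → ℝ} {u : ι → n → ℝ}

theorem sum_eq_one [Nonempty n] (h : IsIsotropic c u) : ∑ i, c i = 1 := by
  have := congrArg trace h.sum_smul_vecMulVec
  simpa [trace_sum, trace_smul, trace_vecMulVec, h.dotProduct_self] using this

theorem sum_mul_dotProduct_sq (h : IsIsotropic c u) (z : n → ℝ) :
    ∑ i, c i * (z ⬝ᵥ u i) ^ 2 = (Fintype.card n : ℝ)⁻¹ * (z ⬝ᵥ z) := by
  have := congrArg (fun A ↦ z ⬝ᵥ A *ᵥ z) h.sum_smul_vecMulVec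
  simpa [sum_mulVec, smul_mulVec, vecMulVec_mulVec, dotProduct_sum, dotProduct_smul,
    dotProduct_comm _ z, ← pow_two] using this

end General

theorem sum_mul_triple_product_sq {ι : Type*} [Fintype ι] {c : ι → ℝ} {u : ι → Fin 3 → ℝ}
    (h : IsIsotropic c u) (a : ι) :
    ∑ j, ∑ k, c j * c k * (u a ⬝ᵥ u j ⨯₃ u k) ^ 2 = 2 / 9 := by
  have inner_sum (j : ι) : ∑ k, c j * c k * (u a ⬝ᵥ u j ⨯₃ u k) ^ 2 =
      (c j - c j * (u a ⬝ᵥ u j) ^ 2) / 3 := by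
    simp only [mul_assoc, ← Finset.mul_sum, triple_product_permutation (u a),
      triple_product_permutation (u j), dotProduct_comm (u _) (u a ⨯₃ u j)]
    rw [h.sum_mul_dotProduct_sq, cross_dot_cross, h.dotProduct_self, h.dotProduct_self,
      dotProduct_comm (u j), Fintype.card_fin]
    push_cast
    ring
  simp only [inner_sum, ← Finset.sum_div, Finset.sum_sub_distrib]
  rw [h.sum_eq_one, h.sum_mul_dotProduct_sq, h.dotProduct_self]
  norm_num

end IsIsotropic

theorem exists_planeDet_eq_triple_product (a : Fin 3 → ℝ) :
    ∃ π : (Fin 3 → ℝ) → ℝ × ℝ, ∀ x y, planeDet (π x) (π y) = a ⬝ᵥ x ⨯₃ y := by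
  obtain ⟨b, hb, hba⟩ := exists_ne_zero_dotProduct_eq_zero a
  refine ⟨fun x ↦ (b ⬝ᵥ x, a ⨯₃ b ⬝ᵥ x / (b ⬝ᵥ b)), fun x y ↦ ?_⟩
  have hbb : b ⬝ᵥ b ≠ 0 := by rwa [Ne, dotProduct_self_eq_zero]
  have cross_cross : b ⨯₃ (a ⨯₃ b) ⬝ᵥ x ⨯₃ y = b ⬝ᵥ b * (a ⬝ᵥ x ⨯₃ y) := by
    rw [cross_cross_eq_smul_sub_smul', dotProduct_comm a b, hba, zero_smul, sub_zero,
      smul_dotProduct, smul_eq_mul]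
  rw [cross_dot_cross] at cross_cross
  simp only [planeDet]
  field_simp
  linear_combination cross_cross

theorem exists_half_le_triple_product_sq {c : Fin 6 → ℝ} {u : Fin 6 → Fin 3 → ℝ}
    (h : IsIsotropic c u) : ∃ i j k, 1 / 2 ≤ (u i ⬝ᵥ u j ⨯₃ u k) ^ 2 := by
  obtain ⟨a, ha⟩ := Finite.exists_max c
  have sum_eq := h.sum_eq_one
  have energy_eq := h.sum_mul_triple_product_sq a
  obtain ⟨π, hπ⟩ := exists_planeDet_eq_triple_product (u a)
  rw [Fin.sum_univ_succAbove _ a] at sum_eq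
  simp only [Fin.sum_univ_succAbove _ a, dot_self_cross, cross_self, dotProduct_zero] at energy_eq
  have subdominant : IsSubdominant fun i ↦ c (a.succAbove i) := fun i ↦
    ⟨h.nonneg _, by linarith [ha (a.succAbove i)]⟩
  obtain ⟨j, k, hjk⟩ := subdominant.exists_planeEnergy_le fun i ↦ π (u (a.succAbove i))
  refine ⟨a, a.succAbove j, a.succAbove k, ?_⟩
  simp only [planeEnergy, hπ] at hjk
  norm_num at energy_eq
  linarith

theorem finrank_vectorSpan_vecMulVec_lt_six :
    Module.finrank ℝ (vectorSpan ℝ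
      ((fun s : Fin 3 → ℝ ↦ vecMulVec s s) '' {s | s ⬝ᵥ s = 1})) < 6 := by
  let traceless : (Fin 5 → ℝ) →ₗ[ℝ] Matrix (Fin 3) (Fin 3) ℝ :=
    { toFun := fun x ↦ !![x 0, x 2, x 3; x 2, x 1, x 4; x 3, x 4, -x 0 - x 1]
      map_add' := fun x y ↦ by
        ext i j
        fin_cases i <;> fin_cases j <;> simp [neg_add_eq_sub]
        ring
      map_smul' := fun r x ↦ by
        ext i j
        fin_cases i <;> fin_cases j <;> simp [mul_sub] }
  have span_le : vectorSpan ℝ ((fun s : Fin 3 → ℝ ↦ vecMulVec s s) '' {s | s ⬝ᵥ s = 1}) ≤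
      LinearMap.range traceless := by
    refine Submodule.span_le.2 ?_
    rintro _ ⟨_, ⟨s, hs, rfl⟩, _, ⟨t, ht, rfl⟩, rfl⟩
    refine ⟨![s 0 * s 0 - t 0 * t 0, s 1 * s 1 - t 1 * t 1, s 0 * s 1 - t 0 * t 1,
      s 0 * s 2 - t 0 * t 2, s 1 * s 2 - t 1 * t 2], ?_⟩
    simp only [Set.mem_ofPred_eq, vec3_dotProduct] at hs ht
    ext i j
    fin_cases i <;> fin_cases j <;> simp [traceless, vecMulVec_apply] <;> linarith
  refine Nat.lt_succ_of_le ((Submodule.finrank_mono span_le).trans ?_)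
  simpa using LinearMap.finrank_range_le traceless

theorem exists_isIsotropic_of_maximal {S : Set (Fin 3 → ℝ)} (hS : IsCompact S)
    (hS1 : ∀ s ∈ S, s ⬝ᵥ s ≤ 1)
    (hmax : ∀ R : Matrix (Fin 3) (Fin 3) ℝ, (∀ s ∈ S, R *ᵥ s ⬝ᵥ R *ᵥ s ≤ 1) → R.det ≤ 1) :
    ∃ (c : Fin 6 → ℝ) (u : Fin 6 → Fin 3 → ℝ), IsIsotropic c u ∧ ∀ i, u i ∈ S := by
  have finrank_lt : Module.finrank ℝ
      (vectorSpan ℝ ((fun s : Fin 3 → ℝ ↦ vecMulVec s s) '' {s ∈ S | s ⬝ᵥ s = 1})) < 6 :=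
    (Submodule.finrank_mono (vectorSpan_mono ℝ (Set.image_mono fun _ hs ↦ hs.2))).trans_lt
      finrank_vectorSpan_vecMulVec_lt_six
  obtain ⟨c, hc, z, hz, hsum⟩ := (mem_convexHull_iff_exists_fin finrank_lt).1
    (inv_card_smul_one_mem_convexHull hS hS1 hmax)
  choose u hu huz using hz
  simp only [← huz] at hsum
  exact ⟨c, u, ⟨hc.1, fun i ↦ (hu i).2, hsum⟩, fun i ↦ (hu i).1⟩

theorem triple_product_mulVec (M : Matrix (Fin 3) (Fin 3) ℝ) (x y z : Fin 3 → ℝ) :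
    M *ᵥ x ⬝ᵥ (M *ᵥ y) ⨯₃ (M *ᵥ z) = M.det * (x ⬝ᵥ y ⨯₃ z) := by
  have rows : (of ![M *ᵥ x, M *ᵥ y, M *ᵥ z]) = of ![x, y, z] * Mᵀ := by
    ext i j
    fin_cases i <;> simp [mul_apply, mulVec, dotProduct, mul_comm]
  rw [triple_product_eq_det, triple_product_eq_det, mul_comm]
  exact (congrArg det rows).trans (by rw [det_mul, det_transpose]; rfl)

section MaximalPosition

variable {n : Type*} [Fintype n]

theorem eventually_smul_one_mulVec_le_one [DecidableEq n] {S : Set (n → ℝ)} (hS : IsCompact S) :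
    ∀ᶠ ε : ℝ in 𝓝 0, ∀ s ∈ S,
      ((ε • (1 : Matrix n n ℝ)) *ᵥ s) ⬝ᵥ ((ε • (1 : Matrix n n ℝ)) *ᵥ s) ≤ 1 := by
  refine hS.eventually_forall_of_forall_eventually fun s _ ↦ ?_
  have continuous : Continuous fun z : ℝ × (n → ℝ) ↦
      ((z.1 • (1 : Matrix n n ℝ)) *ᵥ z.2) ⬝ᵥ ((z.1 • (1 : Matrix n n ℝ)) *ᵥ z.2) := by fun_prop
  filter_upwards [continuous.continuousAt.eventually_lt_const (u := 1) (by simp)] with z hz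
    using hz.le

theorem isCompact_setOf_mulVec_le_one {S : Set (n → ℝ)} (hS : S ∈ 𝓝 0) :
    IsCompact {M : Matrix n n ℝ | ∀ s ∈ S, M *ᵥ s ⬝ᵥ M *ᵥ s ≤ 1} := by
  classical
  have closed : IsClosed {M : Matrix n n ℝ | ∀ s ∈ S, M *ᵥ s ⬝ᵥ M *ᵥ s ≤ 1} := by
    simp only [Set.ofPred_forall]
    exact isClosed_biInter fun s _ ↦ isClosed_le (by fun_prop) continuous_const
  have single_mem : ∀ᶠ δ : ℝ in 𝓝[>] 0, ∀ j : n, Pi.single j δ ∈ S := by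
    refine Filter.eventually_all.2 fun j ↦ Filter.Eventually.filter_mono nhdsWithin_le_nhds ?_
    exact (continuous_single j).tendsto' (0 : ℝ) 0 (Pi.single_zero j) hS
  obtain ⟨δ, hδS, hδ : 0 < δ⟩ := (single_mem.and self_mem_nhdsWithin).exists
  refine (isCompact_univ_pi fun _ ↦ isCompact_univ_pi fun _ ↦
    isCompact_Icc (a := -(1 / δ)) (b := 1 / δ)).of_isClosed_subset closed fun M hM i _ j _ ↦ ?_
  have entry_sq_le : (M i j * δ) ^ 2 ≤ 1 := by
    have column_eq : M *ᵥ Pi.single j δ = fun i ↦ M i j * δ := by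
      ext i
      simp [mulVec, dotProduct, Pi.single_apply]
    have norm_le := hM _ (hδS j)
    rw [column_eq] at norm_le
    rw [pow_two]
    exact (Finset.single_le_sum (f := fun i ↦ M i j * δ * (M i j * δ))
      (fun i _ ↦ mul_self_nonneg _) (Finset.mem_univ i)).trans norm_le
  rw [sq_le_one_iff_abs_le_one, abs_mul, abs_of_pos hδ, ← le_div_iff₀ hδ] at entry_sq_le
  exact abs_le.1 entry_sq_le

theorem exists_max_det [DecidableEq n] {S : Set (n → ℝ)} (hS : IsCompact S) (hS0 : S ∈ 𝓝 0) :
    ∃ M : Matrix n n ℝ, 0 < M.det ∧ (∀ s ∈ S, M *ᵥ s ⬝ᵥ M *ᵥ s ≤ 1) ∧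
      ∀ R : Matrix n n ℝ, (∀ s ∈ S, R *ᵥ s ⬝ᵥ R *ᵥ s ≤ 1) → R.det ≤ M.det := by
  obtain ⟨ε, hεS, hε : 0 < ε⟩ := (((eventually_smul_one_mulVec_le_one hS).filter_mono
    nhdsWithin_le_nhds).and (self_mem_nhdsWithin (s := Set.Ioi (0 : ℝ)))).exists
  obtain ⟨M, hM, hmax⟩ := (isCompact_setOf_mulVec_le_one hS0).exists_isMaxOn ⟨_, hεS⟩
    continuous_id.matrix_det.continuousOn
  refine ⟨M, lt_of_lt_of_le ?_ (hmax hεS), hM, fun R hR ↦ hmax hR⟩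
  simpa using pow_pos hε _

end MaximalPosition

theorem exists_matrix_triple_product {S : Set (Fin 3 → ℝ)} (hS : IsCompact S) (hS0 : S ∈ 𝓝 0) :
    ∃ M : Matrix (Fin 3) (Fin 3) ℝ, 0 < M.det ∧ (∀ s ∈ S, M *ᵥ s ⬝ᵥ M *ᵥ s ≤ 1) ∧
      ∃ x ∈ S, ∃ y ∈ S, ∃ z ∈ S, 1 / 2 ≤ (M.det * (x ⬝ᵥ y ⨯₃ z)) ^ 2 := by
  obtain ⟨M, hM, hM1, hmax⟩ := exists_max_det hS hS0
  refine ⟨M, hM, hM1, ?_⟩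
  have image_compact : IsCompact (M.mulVec '' S) := hS.image (by fun_prop)
  obtain ⟨c, u, hu, huS⟩ := exists_isIsotropic_of_maximal image_compact (Set.forall_mem_image.2 hM1)
    fun R hR ↦ by
      have det_le := hmax (R * M) fun s hs ↦ by
        simpa only [mulVec_mulVec] using hR _ (Set.mem_image_of_mem _ hs)
      rwa [det_mul, mul_le_iff_le_one_left hM] at det_le
  obtain ⟨i, j, k, h⟩ := exists_half_le_triple_product_sq hu
  obtain ⟨x, hx, hxu⟩ := huS i
  obtain ⟨y, hy, hyu⟩ := huS j
  obtain ⟨z, hz, hzu⟩ := huS k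
  rw [← hxu, ← hyu, ← hzu, triple_product_mulVec] at h
  exact ⟨x, hx, y, hy, z, hz, h⟩

/-! ### Volumes of bodies and of simplices -/

section ConeVolume

open MeasureTheory
open scoped Pointwise

theorem setLIntegral_one_sub_pow (n : ℕ) :
    ∫⁻ t in Set.Icc (0 : ℝ) 1, ENNReal.ofReal ((1 - t) ^ n) = ENNReal.ofReal (1 / (n + 1)) := by
  rw [← ofReal_integral_eq_lintegral_ofReal]
  · rw [integral_Icc_eq_integral_Ioc, ← intervalIntegral.integral_of_le zero_le_one,
      intervalIntegral.integral_comp_sub_left (fun t ↦ t ^ n) 1]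
    simp
  · exact (by fun_prop : Continuous fun t : ℝ ↦ (1 - t) ^ n).integrableOn_Icc
  · filter_upwards [ae_restrict_mem measurableSet_Icc] with t ht
    exact pow_nonneg (sub_nonneg.2 ht.2) n

theorem setLIntegral_measure_ofReal_le_le_lintegral {α : Type*} [MeasurableSpace α] (μ : Measure α)
    {f : α → ENNReal} (hf : Measurable f) :
    ∫⁻ t in Set.Icc (0 : ℝ) 1, μ {a | ENNReal.ofReal t ≤ f a} ≤ ∫⁻ a, f a ∂μ := by
  have min_ne_top (a : α) : min (f a) 1 ≠ ⊤ := (min_le_right _ _).trans_lt ENNReal.one_lt_top |>.ne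
  calc ∫⁻ t in Set.Icc (0 : ℝ) 1, μ {a | ENNReal.ofReal t ≤ f a}
      ≤ ∫⁻ t in Set.Icc (0 : ℝ) 1, μ {a | t ≤ (min (f a) 1).toReal} := by
        refine setLIntegral_mono' measurableSet_Icc fun t ht ↦ measure_mono fun a ha ↦ ?_
        exact (ENNReal.ofReal_le_iff_le_toReal (min_ne_top a)).1
          (le_min ha (ENNReal.ofReal_le_one.2 ht.2))
    _ = ∫⁻ t in Set.Ioc (0 : ℝ) 1, μ {a | t ≤ (min (f a) 1).toReal} := by
        rw [restrict_Ioc_eq_restrict_Icc]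
    _ ≤ ∫⁻ t in Set.Ioi (0 : ℝ), μ {a | t ≤ (min (f a) 1).toReal} :=
        lintegral_mono_set Set.Ioc_subset_Ioi_self
    _ = ∫⁻ a, ENNReal.ofReal (min (f a) 1).toReal ∂μ :=
        (lintegral_eq_lintegral_meas_le μ (.of_forall fun _ ↦ ENNReal.toReal_nonneg)
          (hf.min measurable_const).ennreal_toReal.aemeasurable).symm
    _ ≤ ∫⁻ a, f a ∂μ := lintegral_mono fun a ↦ by
        rw [ENNReal.ofReal_toReal (min_ne_top a)]
        exact min_le_left _ _

section Slices

variable {n : ℕ} {K : Set (Fin (n + 1) → ℝ)}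

theorem measurableSet_setOf_cons_mem (hK : MeasurableSet K) :
    MeasurableSet {p : ℝ × (Fin n → ℝ) | (Fin.cons p.1 p.2 : Fin (n + 1) → ℝ) ∈ K} :=
  (Continuous.finCons continuous_fst continuous_snd).measurable hK

theorem volume_eq_volume_setOf_cons_mem : volume K =
    volume {p : ℝ × (Fin n → ℝ) | (Fin.cons p.1 p.2 : Fin (n + 1) → ℝ) ∈ K} := by
  rw [← (volume_preserving_piFinSuccAbove (fun _ : Fin (n + 1) ↦ ℝ) 0).symm.measure_preimage_equiv]
  congr 1
  ext p
  change Fin.insertNth 0 p.1 p.2 ∈ K ↔ _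
  rw [Fin.insertNth_zero]
  rfl

theorem volume_eq_lintegral_slice (hK : MeasurableSet K) : volume K =
    ∫⁻ t : ℝ, volume {y : Fin n → ℝ | (Fin.cons t y : Fin (n + 1) → ℝ) ∈ K} := by
  rw [volume_eq_volume_setOf_cons_mem, Measure.volume_eq_prod,
    Measure.prod_apply (measurableSet_setOf_cons_mem hK)]
  rfl

theorem volume_eq_lintegral_fiber (hK : MeasurableSet K) : volume K =
    ∫⁻ y : Fin n → ℝ, volume {t : ℝ | (Fin.cons t y : Fin (n + 1) → ℝ) ∈ K} := by
  rw [volume_eq_volume_setOf_cons_mem, Measure.volume_eq_prod,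
    Measure.prod_apply_symm (measurableSet_setOf_cons_mem hK)]
  rfl

theorem ofReal_le_volume_fiber_homothety (hconv : Convex ℝ K) {a x : Fin (n + 1) → ℝ} (ha : a ∈ K)
    (ha1 : a + Pi.single 0 1 ∈ K) (hx : x ∈ K) {t : ℝ} (ht : t ∈ Set.Icc 0 1) :
    ENNReal.ofReal t ≤ volume {s : ℝ | (Fin.cons s
      (AffineMap.homothety (Fin.tail a) (1 - t) (Fin.tail x)) : Fin (n + 1) → ℝ) ∈ K} := by
  set r := t * a 0 + (1 - t) * x 0 with hr
  have segment_subset : Set.Icc r (r + t) ⊆ {s : ℝ | (Fin.cons s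
      (AffineMap.homothety (Fin.tail a) (1 - t) (Fin.tail x)) : Fin (n + 1) → ℝ) ∈ K} := by
    intro s hs
    have combination_mem : ∑ i, ![r + t - s, s - r, 1 - t] i • ![a, a + Pi.single 0 1, x] i ∈ K :=
      hconv.sum_mem (by simp [Fin.forall_fin_succ, hs.1, hs.2, ht.2])
        (by simp [Fin.sum_univ_three]) (by simp [Fin.forall_fin_succ, ha, ha1, hx])
    rw [Set.mem_ofPred_eq]
    convert combination_mem using 1
    rw [Fin.sum_univ_three]
    ext i
    cases i using Fin.cases with
    | zero => simp [hr]; ring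
    | succ i => simp [AffineMap.homothety_apply, Fin.tail]; ring
  simpa using measure_mono (μ := volume) segment_subset

theorem volume_tail_image_le (hK : MeasurableSet K) (hconv : Convex ℝ K) {a : Fin (n + 1) → ℝ}
    (ha : a ∈ K) (ha1 : a + Pi.single 0 1 ∈ K) :
    ENNReal.ofReal (1 / (n + 1)) * volume (Fin.tail '' K) ≤ volume K := by
  calc ENNReal.ofReal (1 / (n + 1)) * volume (Fin.tail '' K)
      = ∫⁻ t in Set.Icc (0 : ℝ) 1, ENNReal.ofReal ((1 - t) ^ n) * volume (Fin.tail '' K) := by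
        rw [lintegral_mul_const _ (by fun_prop), setLIntegral_one_sub_pow]
    _ = ∫⁻ t in Set.Icc (0 : ℝ) 1,
          volume (AffineMap.homothety (Fin.tail a) (1 - t) '' (Fin.tail '' K)) := by
        refine setLIntegral_congr_fun measurableSet_Icc fun t ht ↦ ?_
        rw [Measure.addHaar_image_homothety, Module.finrank_fin_fun,
          abs_of_nonneg (pow_nonneg (sub_nonneg.2 ht.2) n)]
    _ ≤ ∫⁻ t in Set.Icc (0 : ℝ) 1, volume {y : Fin n → ℝ |
          ENNReal.ofReal t ≤ volume {s : ℝ | (Fin.cons s y : Fin (n + 1) → ℝ) ∈ K}} := by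
        refine setLIntegral_mono' measurableSet_Icc fun t ht ↦ measure_mono ?_
        rintro _ ⟨_, ⟨x, hx, rfl⟩, rfl⟩
        exact ofReal_le_volume_fiber_homothety hconv ha ha1 hx ht
    _ ≤ ∫⁻ y : Fin n → ℝ, volume {s : ℝ | (Fin.cons s y : Fin (n + 1) → ℝ) ∈ K} :=
        setLIntegral_measure_ofReal_le_le_lintegral _
          (measurable_measure_prodMk_right (measurableSet_setOf_cons_mem hK))
    _ = volume K := (volume_eq_lintegral_fiber hK).symm

end Slices

theorem inv_factorial_succ (n : ℕ) :
    ENNReal.ofReal (1 / (n + 1)) * ENNReal.ofReal (1 / n.factorial) =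
      ENNReal.ofReal (1 / (n + 1).factorial) := by
  rw [← ENNReal.ofReal_mul (by positivity), Nat.factorial_succ, one_div_mul_one_div]
  push_cast
  rfl

theorem inv_factorial_le_volume {n : ℕ} {K : Set (Fin n → ℝ)} (hK : IsCompact K)
    (hconv : Convex ℝ K) (hne : K.Nonempty) (hseg : ∀ i, ∃ a ∈ K, a + Pi.single i 1 ∈ K) :
    ENNReal.ofReal (1 / n.factorial) ≤ volume K := by
  induction n with
  | zero => simp [hne.eq_univ, volume_pi]
  | succ n ih =>
    obtain ⟨a, ha, ha1⟩ := hseg 0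
    refine le_trans ?_ (volume_tail_image_le hK.measurableSet hconv ha ha1)
    rw [← inv_factorial_succ]
    gcongr
    refine ih (hK.image (by unfold Fin.tail; fun_prop))
      (hconv.linear_image (LinearMap.funLeft ℝ ℝ Fin.succ)) (hne.image _) fun i ↦ ?_
    obtain ⟨b, hb, hb1⟩ := hseg i.succ
    refine ⟨Fin.tail b, ⟨b, hb, rfl⟩, ⟨_, hb1, ?_⟩⟩
    ext j
    simp [Fin.tail, Pi.single_apply]

theorem volume_image_mulVec {n : Type*} [Fintype n] [DecidableEq n] (M : Matrix n n ℝ)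
    (s : Set (n → ℝ)) : volume (M.mulVec '' s) = ENNReal.ofReal |M.det| * volume s := by
  rw [← LinearMap.det_toLin', ← Measure.addHaar_image_linearMap]
  rfl

theorem abs_det_div_factorial_le_volume {n : ℕ} {K : Set (Fin n → ℝ)} (hK : IsCompact K)
    (hconv : Convex ℝ K) (hne : K.Nonempty) (v : Matrix (Fin n) (Fin n) ℝ)
    (hseg : ∀ i, ∃ a ∈ K, a + v i ∈ K) :
    ENNReal.ofReal (|v.det| / n.factorial) ≤ volume K := by
  by_cases hv : v.det = 0
  · simp [hv]
  have hu : IsUnit vᵀ.det := by rwa [det_transpose, isUnit_iff_ne_zero]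
  have mulVec_row (i : Fin n) : (vᵀ)⁻¹ *ᵥ v i = Pi.single i 1 := by
    have row_eq : v i = vᵀ *ᵥ Pi.single i 1 := by
      rw [mulVec_single_one]
      rfl
    rw [row_eq, mulVec_mulVec, nonsing_inv_mul _ hu, one_mulVec]
  have inv_factorial_le : ENNReal.ofReal (1 / n.factorial) ≤ volume ((vᵀ)⁻¹.mulVec '' K) := by
    refine inv_factorial_le_volume (hK.image (by fun_prop)) (hconv.linear_image (toLin' (vᵀ)⁻¹))
      (hne.image _) fun i ↦ ?_
    obtain ⟨a, ha, hav⟩ := hseg i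
    exact ⟨_, ⟨a, ha, rfl⟩, _, hav, by rw [mulVec_add, mulVec_row]⟩
  calc ENNReal.ofReal (|v.det| / n.factorial)
      = ENNReal.ofReal |vᵀ.det| * ENNReal.ofReal (1 / n.factorial) := by
        rw [← ENNReal.ofReal_mul (abs_nonneg _), mul_one_div, det_transpose]
    _ ≤ ENNReal.ofReal |vᵀ.det| * volume ((vᵀ)⁻¹.mulVec '' K) := by gcongr
    _ = volume K := by
        rw [← volume_image_mulVec, Set.image_image]
        simp only [mulVec_mulVec, mul_nonsing_inv _ hu, one_mulVec, Set.image_id']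

/-- The simplex spanned by the origin and the standard basis vectors of `ℝⁿ`, against which the
volumes of all other simplices are measured. -/
def cornerSimplex (n : ℕ) : Set (Fin n → ℝ) := {x | (∀ i, 0 ≤ x i) ∧ ∑ i, x i ≤ 1}

theorem isClosed_cornerSimplex (n : ℕ) : IsClosed (cornerSimplex n) :=
  (isClosed_Ici (a := (0 : Fin n → ℝ))).inter (isClosed_le
    (continuous_finsetSum _ fun i _ ↦ continuous_apply i) continuous_const)

theorem convex_cornerSimplex (n : ℕ) : Convex ℝ (cornerSimplex n) := by
  have convex_sum_le : Convex ℝ {x : Fin n → ℝ | ∑ i, x i ≤ 1} := convex_halfSpace_le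
    ⟨fun _ _ ↦ Finset.sum_add_distrib, fun _ _ ↦ (Finset.mul_sum _ _ _).symm⟩ 1
  exact (convex_Ici (0 : Fin n → ℝ)).inter convex_sum_le

theorem cons_mem_cornerSimplex_iff {n : ℕ} {t : ℝ} {y : Fin n → ℝ} :
    (Fin.cons t y : Fin (n + 1) → ℝ) ∈ cornerSimplex (n + 1) ↔
      (0 ≤ t ∧ ∀ i, 0 ≤ y i) ∧ t + ∑ i, y i ≤ 1 := by
  simp [cornerSimplex, Fin.forall_fin_succ, Fin.sum_univ_succ]

theorem setOf_cons_mem_cornerSimplex_subset {n : ℕ} {t : ℝ} (ht : t ≤ 1) :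
    {y : Fin n → ℝ | (Fin.cons t y : Fin (n + 1) → ℝ) ∈ cornerSimplex (n + 1)} ⊆
      (1 - t) • cornerSimplex n := by
  intro y hy
  obtain ⟨⟨-, y_nonneg⟩, sum_le⟩ := cons_mem_cornerSimplex_iff.1 hy
  rcases ht.eq_or_lt with rfl | ht
  · have y_eq : y = 0 := by
      refine (Fintype.sum_eq_zero_iff_of_nonneg y_nonneg).1 ?_
      exact le_antisymm (by linarith) (Finset.sum_nonneg fun i _ ↦ y_nonneg i)
    rw [y_eq, sub_self]
    exact ⟨0, ⟨fun _ ↦ le_rfl, by simp⟩, smul_zero _⟩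
  · have sub_pos : 0 < 1 - t := sub_pos.2 ht
    rw [Set.mem_smul_set_iff_inv_smul_mem₀ sub_pos.ne']
    refine ⟨fun i ↦ mul_nonneg (inv_nonneg.2 sub_pos.le) (y_nonneg i), ?_⟩
    simp only [Pi.smul_apply, smul_eq_mul, ← Finset.mul_sum]
    rw [inv_mul_le_one₀ sub_pos]
    linarith

theorem volume_cornerSimplex_le (n : ℕ) :
    volume (cornerSimplex n) ≤ ENNReal.ofReal (1 / n.factorial) := by
  induction n with
  | zero => exact (measure_mono (Set.subset_univ _)).trans (by simp [volume_pi])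
  | succ n ih =>
    have slice_le (t : ℝ) : volume {y : Fin n → ℝ |
        (Fin.cons t y : Fin (n + 1) → ℝ) ∈ cornerSimplex (n + 1)} ≤
        (Set.Icc (0 : ℝ) 1).indicator
          (fun t ↦ ENNReal.ofReal ((1 - t) ^ n) * ENNReal.ofReal (1 / n.factorial)) t := by
      by_cases ht : t ∈ Set.Icc (0 : ℝ) 1
      · rw [Set.indicator_of_mem ht]
        refine (measure_mono (setOf_cons_mem_cornerSimplex_subset ht.2)).trans ?_
        rw [Measure.addHaar_smul, Module.finrank_fin_fun,
          abs_of_nonneg (pow_nonneg (sub_nonneg.2 ht.2) n)]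
        gcongr
      · have slice_empty : {y : Fin n → ℝ |
            (Fin.cons t y : Fin (n + 1) → ℝ) ∈ cornerSimplex (n + 1)} = ∅ := by
          refine Set.eq_empty_of_forall_notMem fun y hy ↦ ht ?_
          obtain ⟨⟨t_nonneg, y_nonneg⟩, sum_le⟩ := cons_mem_cornerSimplex_iff.1 hy
          exact ⟨t_nonneg, by linarith [Finset.sum_nonneg fun i (_ : i ∈ Finset.univ) ↦ y_nonneg i]⟩
        rw [slice_empty, measure_empty]
        exact zero_le
    calc volume (cornerSimplex (n + 1))
        ≤ ∫⁻ t in Set.Icc (0 : ℝ) 1,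
            ENNReal.ofReal ((1 - t) ^ n) * ENNReal.ofReal (1 / n.factorial) := by
          rw [volume_eq_lintegral_slice (isClosed_cornerSimplex _).measurableSet,
            ← lintegral_indicator measurableSet_Icc]
          exact lintegral_mono slice_le
      _ = ENNReal.ofReal (1 / (n + 1).factorial) := by
          rw [lintegral_mul_const _ (by fun_prop), setLIntegral_one_sub_pow, inv_factorial_succ]

theorem convexHull_range_subset_image_cornerSimplex {n : ℕ} (w : Fin (n + 1) → Fin n → ℝ) :
    convexHull ℝ (Set.range w) ⊆ (w 0 + ·) ''
      ((of fun i ↦ w (Fin.succ i) - w 0)ᵀ.mulVec '' cornerSimplex n) := by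
  refine convexHull_min ?_ (((convex_cornerSimplex n).linear_image (toLin' _)).translate (w 0))
  rintro _ ⟨i, rfl⟩
  refine Fin.cases ?_ (fun j ↦ ?_) i
  · exact ⟨0, ⟨0, ⟨fun _ ↦ le_rfl, by simp⟩, mulVec_zero _⟩, add_zero _⟩
  · refine ⟨w j.succ - w 0, ⟨Pi.single j 1, ⟨fun i ↦ ?_, by simp⟩, ?_⟩, add_sub_cancel _ _⟩
    · exact (Pi.single_nonneg.2 zero_le_one : (0 : Fin n → ℝ) ≤ Pi.single j 1) i
    · rw [mulVec_single_one]
      rfl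

theorem volume_convexHull_range {n : ℕ} (w : Fin (n + 1) → Fin n → ℝ) :
    volume (convexHull ℝ (Set.range w)) =
      ENNReal.ofReal (|(of fun i ↦ w (Fin.succ i) - w 0).det| / n.factorial) := by
  have vertex_mem (i) : w i ∈ convexHull ℝ (Set.range w) := subset_convexHull ℝ _ ⟨i, rfl⟩
  refine le_antisymm ?_ (abs_det_div_factorial_le_volume
    ((Set.finite_range w).isCompact_convexHull ℝ) (convex_convexHull ℝ _) ⟨_, vertex_mem 0⟩ _
    fun i ↦ ⟨w 0, vertex_mem 0, Set.mem_of_eq_of_mem (add_sub_cancel _ _) (vertex_mem i.succ)⟩)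
  refine (measure_mono (convexHull_range_subset_image_cornerSimplex w)).trans ?_
  rw [Set.image_add_left, measure_preimage_add, volume_image_mulVec, det_transpose,
    ← mul_one_div, ENNReal.ofReal_mul (abs_nonneg _)]
  gcongr
  exact volume_cornerSimplex_le n

end ConeVolume

section Tetrahedron

theorem triple_product_sq_le (x y z : Fin 3 → ℝ) :
    (x ⬝ᵥ y ⨯₃ z) ^ 2 ≤ (x ⬝ᵥ x) * (y ⬝ᵥ y) * (z ⬝ᵥ z) := by
  have dotProduct_sq_le : (x ⬝ᵥ y ⨯₃ z) ^ 2 ≤ (x ⬝ᵥ x) * (y ⨯₃ z ⬝ᵥ y ⨯₃ z) := by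
    simpa only [dotProduct, ← pow_two] using Finset.sum_mul_sq_le_sq_mul_sq Finset.univ x (y ⨯₃ z)
  have cross_le : y ⨯₃ z ⬝ᵥ y ⨯₃ z ≤ (y ⬝ᵥ y) * (z ⬝ᵥ z) := by
    rw [cross_dot_cross, dotProduct_comm z y]
    exact sub_le_self _ (mul_self_nonneg _)
  have self_nonneg : 0 ≤ x ⬝ᵥ x := Finset.sum_nonneg fun i _ ↦ mul_self_nonneg (x i)
  rw [mul_assoc]
  exact dotProduct_sq_le.trans (by gcongr)

theorem dotProduct_add_self_add_dotProduct_sub_self {n : Type*} [Fintype n] (x y : n → ℝ) :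
    (x + y) ⬝ᵥ (x + y) + (x - y) ⬝ᵥ (x - y) = 2 * (x ⬝ᵥ x + y ⬝ᵥ y) := by
  simp only [dotProduct_add, add_dotProduct, dotProduct_sub, sub_dotProduct]
  ring

theorem eight_mul_mul_mul_le {x y z : ℝ} (hx : 0 ≤ x) (hy : 0 ≤ y) (hz : 0 ≤ z) :
    8 * (x * y * z) ≤ (x + y) * (x + z) * (y + z) := by
  linarith [mul_nonneg hx (sq_nonneg (y - z)), mul_nonneg hy (sq_nonneg (x - z)),
    mul_nonneg hz (sq_nonneg (x - y))]

/- With edges `a, b, c` at one vertex, `b + c - a`, `a + c - b` and `a + b - c` are the edges of the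
circumscribed parallelepiped; for the regular tetrahedron it is a cube, so Hadamard's inequality is
an equality there. -/
theorem two_mul_triple_product_sq_le {a b c : Fin 3 → ℝ} {D : ℝ} (ha : a ⬝ᵥ a ≤ D)
    (hb : b ⬝ᵥ b ≤ D) (hc : c ⬝ᵥ c ≤ D) (hab : (a - b) ⬝ᵥ (a - b) ≤ D)
    (hac : (a - c) ⬝ᵥ (a - c) ≤ D) (hbc : (b - c) ⬝ᵥ (b - c) ≤ D) :
    2 * (a ⬝ᵥ b ⨯₃ c) ^ 2 ≤ D ^ 3 := by
  have self_nonneg (x : Fin 3 → ℝ) : 0 ≤ x ⬝ᵥ x := Finset.sum_nonneg fun i _ ↦ mul_self_nonneg _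
  have triple_eq : (b + c - a) ⬝ᵥ (a + c - b) ⨯₃ (a + b - c) = 4 * (a ⬝ᵥ b ⨯₃ c) := by
    simp only [cross_apply, vec3_dotProduct, cons_val, Pi.add_apply, Pi.sub_apply]
    ring
  set X := (b + c - a) ⬝ᵥ (b + c - a)
  set Y := (a + c - b) ⬝ᵥ (a + c - b)
  set Z := (a + b - c) ⬝ᵥ (a + b - c)
  have add_le {p q x y : Fin 3 → ℝ} (hx : x ⬝ᵥ x ≤ D) (hy : y ⬝ᵥ y ≤ D) (hp : p = x - y)
      (hq : q = x + y) : p ⬝ᵥ p + q ⬝ᵥ q ≤ 4 * D := by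
    rw [hp, hq, add_comm, dotProduct_add_self_add_dotProduct_sub_self]
    linarith
  have hXY : X + Y ≤ 4 * D := add_le hc hab (by abel) (by abel)
  have hXZ : X + Z ≤ 4 * D := add_le hb hac (by abel) (by abel)
  have hYZ : Y + Z ≤ 4 * D := add_le ha hbc (by abel) (by abel)
  have hX : 0 ≤ X := self_nonneg _
  have hY : 0 ≤ Y := self_nonneg _
  have hZ : 0 ≤ Z := self_nonneg _
  have hadamard : (4 * (a ⬝ᵥ b ⨯₃ c)) ^ 2 ≤ X * Y * Z := triple_eq ▸ triple_product_sq_le _ _ _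
  have product_le : (X + Y) * (X + Z) * (Y + Z) ≤ (4 * D) * (4 * D) * (4 * D) := by
    have hD : 0 ≤ D := (self_nonneg a).trans ha
    gcongr
  linarith [eight_mul_mul_mul_le hX hY hZ]

end Tetrahedron

section EuclideanSpace

open MeasureTheory
open scoped Pointwise

variable {n : Type*} [Fintype n]

theorem dist_sq_eq_dotProduct (x y : EuclideanSpace ℝ n) :
    dist x y ^ 2 = (x.ofLp - y.ofLp) ⬝ᵥ (x.ofLp - y.ofLp) := by
  rw [dist_eq_norm, EuclideanSpace.real_norm_sq_eq]
  simp [dotProduct, pow_two]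

theorem volume_image_ofLp (s : Set (EuclideanSpace ℝ n)) :
    volume (WithLp.ofLp '' s) = volume s := by
  have volume_preserving := (EuclideanSpace.volume_preserving_symm_measurableEquiv_toLp n).symm
  rw [← volume_preserving.measure_preimage_equiv s]
  congr 1
  exact (WithLp.equiv 2 (n → ℝ)).image_eq_preimage_symm s

theorem exists_linearEquiv_ofLp_eq_mulVec [DecidableEq n] {M : Matrix n n ℝ} (hM : M.det ≠ 0) :
    ∃ T : EuclideanSpace ℝ n ≃ₗ[ℝ] EuclideanSpace ℝ n, ∀ x, (T x).ofLp = M *ᵥ x.ofLp :=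
  ⟨(WithLp.linearEquiv 2 ℝ (n → ℝ)).trans
    (((toLin' M).equivOfDetNeZero (by rwa [LinearMap.det_toLin'])).trans
      (WithLp.linearEquiv 2 ℝ (n → ℝ)).symm), fun _ ↦ rfl⟩

theorem sub_self_mem_nhds_zero {G : Type*} [AddGroup G] [TopologicalSpace G] [ContinuousAdd G]
    {s : Set G} {x : G} (hs : s ∈ 𝓝 x) : s - s ∈ 𝓝 0 := by
  have translate_mem : (· + x) ⁻¹' s ∈ 𝓝 (0 : G) :=
    (continuous_add_const x).tendsto' 0 x (zero_add x) hs
  filter_upwards [translate_mem] with y hy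
  exact ⟨y + x, hy, x, mem_of_mem_nhds hs, add_sub_cancel_right y x⟩

theorem exists_matrix_sqrt_two_div_twelve_le {L : Set (Fin 3 → ℝ)} (hconv : Convex ℝ L)
    (hL : IsCompact L) {x₀ : Fin 3 → ℝ} (hx₀ : L ∈ 𝓝 x₀) :
    ∃ M : Matrix (Fin 3) (Fin 3) ℝ, 0 < M.det ∧
      (∀ p ∈ L, ∀ q ∈ L, M *ᵥ (p - q) ⬝ᵥ M *ᵥ (p - q) ≤ 1) ∧
      √2 / 12 ≤ M.det * volume.real L := by
  have diff_compact : IsCompact (L - L) := sub_eq_add_neg L L ▸ hL.add hL.neg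
  obtain ⟨M, hM, hM1, x, hx, y, hy, z, hz, hdet⟩ :=
    exists_matrix_triple_product diff_compact (sub_self_mem_nhds_zero hx₀)
  refine ⟨M, hM, fun p hp q hq ↦ hM1 _ (Set.sub_mem_sub hp hq), ?_⟩
  have translate_mem : ∀ s ∈ L - L, ∃ a ∈ L, a + s ∈ L := by
    rintro _ ⟨p, hp, q, hq, rfl⟩
    exact ⟨q, hq, by rwa [add_sub_cancel]⟩
  have triple_le_volume : |x ⬝ᵥ y ⨯₃ z| / 6 ≤ volume.real L := by
    have det_le := abs_det_div_factorial_le_volume hL hconv ⟨x₀, mem_of_mem_nhds hx₀⟩ ![x, y, z]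
      (by simp [Fin.forall_fin_succ, translate_mem, hx, hy, hz])
    rw [ENNReal.ofReal_le_iff_le_toReal hL.measure_lt_top.ne, ← triple_product_eq_det] at det_le
    simpa [Nat.factorial, Measure.real] using det_le
  have sqrt_le : √2 / 2 ≤ M.det * |x ⬝ᵥ y ⨯₃ z| := by
    rw [← abs_of_pos hM, ← abs_mul]
    refine (abs_le_of_sq_le_sq' ?_ (abs_nonneg _)).2
    rw [sq_abs, div_pow, Real.sq_sqrt zero_le_two]
    linarith
  linarith [mul_le_mul_of_nonneg_left triple_le_volume hM.le]

theorem exists_linearEquiv_sqrt_two_div_twelve_mul_diam_le {K : Set (EuclideanSpace ℝ (Fin 3))}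
    (hK : IsConvexBody3 K) :
    ∃ T : EuclideanSpace ℝ (Fin 3) ≃ₗ[ℝ] EuclideanSpace ℝ (Fin 3),
      √2 / 12 * Metric.diam (T '' K) ^ 3 ≤ volume.real (T '' K) := by
  obtain ⟨hconv, hcomp, x₀, hx₀⟩ := hK
  have image_mem_nhds : WithLp.ofLp '' K ∈ 𝓝 x₀.ofLp :=
    (PiLp.homeomorph 2 fun _ : Fin 3 ↦ ℝ).isOpenMap.image_mem_nhds (mem_interior_iff_mem_nhds.1 hx₀)
  obtain ⟨M, hM, hM1, hvol⟩ := exists_matrix_sqrt_two_div_twelve_le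
    (hconv.linear_image (WithLp.linearEquiv 2 ℝ (Fin 3 → ℝ)).toLinearMap)
    (hcomp.image (by fun_prop)) image_mem_nhds
  obtain ⟨T, hT⟩ := exists_linearEquiv_ofLp_eq_mulVec hM.ne'
  refine ⟨T, ?_⟩
  have diam_le : Metric.diam (T '' K) ≤ 1 := by
    refine Metric.diam_le_of_forall_dist_le zero_le_one ?_
    rintro _ ⟨p, hp, rfl⟩ _ ⟨q, hq, rfl⟩
    rw [← sq_le_one_iff₀ dist_nonneg, dist_sq_eq_dotProduct, hT, hT, ← mulVec_sub]
    exact hM1 _ ⟨p, hp, rfl⟩ _ ⟨q, hq, rfl⟩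
  have volume_eq : volume.real (T '' K) = M.det * volume.real (WithLp.ofLp '' K) := by
    have image_eq : WithLp.ofLp '' (T '' K) = M.mulVec '' (WithLp.ofLp '' K) := by
      simp only [Set.image_image, hT]
    rw [Measure.real, ← volume_image_ofLp, image_eq, volume_image_mulVec, ENNReal.toReal_mul,
      abs_of_pos hM, ENNReal.toReal_ofReal hM.le, Measure.real]
  calc √2 / 12 * Metric.diam (T '' K) ^ 3 ≤ √2 / 12 * 1 := by
        gcongr
        exact pow_le_one₀ Metric.diam_nonneg diam_le
    _ ≤ volume.real (T '' K) := by rwa [mul_one, volume_eq]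

theorem volume_real_convexHull_range_fin_four (w : Fin 4 → EuclideanSpace ℝ (Fin 3)) :
    volume.real (convexHull ℝ (Set.range w)) =
      |(w 1 - w 0).ofLp ⬝ᵥ (w 2 - w 0).ofLp ⨯₃ (w 3 - w 0).ofLp| / 6 := by
  have image_eq : WithLp.ofLp '' convexHull ℝ (Set.range w) =
      convexHull ℝ (Set.range fun i ↦ (w i).ofLp) := by
    rw [Set.range_comp' WithLp.ofLp w]
    exact (WithLp.linearEquiv 2 ℝ (Fin 3 → ℝ)).toLinearMap.image_convexHull _
  have rows_eq : (of fun i : Fin 3 ↦ (w i.succ).ofLp - (w 0).ofLp) =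
      ![(w 1 - w 0).ofLp, (w 2 - w 0).ofLp, (w 3 - w 0).ofLp] := by
    ext i j
    fin_cases i <;> rfl
  rw [Measure.real, ← volume_image_ofLp, image_eq, volume_convexHull_range, rows_eq,
    triple_product_eq_det, ENNReal.toReal_ofReal (by positivity)]
  rfl

theorem volume_real_convexHull_range_le (w : Fin 4 → EuclideanSpace ℝ (Fin 3)) :
    volume.real (convexHull ℝ (Set.range w)) ≤
      √2 / 12 * Metric.diam (convexHull ℝ (Set.range w)) ^ 3 := by
  rw [volume_real_convexHull_range_fin_four, convexHull_diam]
  set d := Metric.diam (Set.range w)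
  have edge_le (i j) : (w i - w j).ofLp ⬝ᵥ (w i - w j).ofLp ≤ d ^ 2 := by
    rw [WithLp.ofLp_sub, ← dist_sq_eq_dotProduct]
    gcongr
    exact Metric.dist_le_diam_of_mem (Set.finite_range w).isBounded ⟨i, rfl⟩ ⟨j, rfl⟩
  have triple_le := two_mul_triple_product_sq_le (edge_le 1 0) (edge_le 2 0) (edge_le 3 0)
    (by simpa using edge_le 1 2) (by simpa using edge_le 1 3) (by simpa using edge_le 2 3)
  have abs_le : |(w 1 - w 0).ofLp ⬝ᵥ (w 2 - w 0).ofLp ⨯₃ (w 3 - w 0).ofLp| ≤ √2 / 2 * d ^ 3 := by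
    refine abs_le_of_sq_le_sq ?_ (mul_nonneg (by positivity) (pow_nonneg Metric.diam_nonneg 3))
    rw [mul_pow, div_pow, Real.sq_sqrt zero_le_two]
    linarith
  linarith

end EuclideanSpace

section AffineIndependent

variable {k V : Type*} [Field k] [AddCommGroup V] [Module k V] {n : ℕ}

theorem affineIndependent_iff_linearIndependent_succ_sub {v : Fin (n + 1) → V} :
    AffineIndependent k v ↔ LinearIndependent k fun i : Fin n ↦ v i.succ - v 0 := by
  rw [affineIndependent_iff_linearIndependent_vsub k v 0,
    ← linearIndependent_equiv (finSuccAboveEquiv 0)]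
  rfl

theorem exists_linearEquiv_apply_sub [FiniteDimensional k V] (hn : Module.finrank k V = n)
    {v w : Fin (n + 1) → V} (hv : AffineIndependent k v) (hw : AffineIndependent k w) :
    ∃ T : V ≃ₗ[k] V, ∀ i, T (v i - v 0) = w i - w 0 := by
  have card_eq : Fintype.card (Fin n) = Module.finrank k V := by rw [hn, Fintype.card_fin]
  set bv := basisOfLinearIndependentOfCardEqFinrank' _
    (affineIndependent_iff_linearIndependent_succ_sub.1 hv) card_eq with hbv
  set bw := basisOfLinearIndependentOfCardEqFinrank' _
    (affineIndependent_iff_linearIndependent_succ_sub.1 hw) card_eq with hbw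
  refine ⟨bv.equiv bw (Equiv.refl _), Fin.cases ?_ fun i ↦ ?_⟩
  · rw [sub_self, sub_self, map_zero]
  · simpa [hbv, hbw] using bv.equiv_apply i bw (Equiv.refl _)

end AffineIndependent

section RegularTetrahedron

open MeasureTheory

/-- The vertices of a regular tetrahedron inscribed in the unit cube, so that its edges are face
diagonals, of length `√2`. -/
def regularTetrahedron : Fin 4 → EuclideanSpace ℝ (Fin 3) :=
  ![0, !₂[0, 1, 1], !₂[1, 0, 1], !₂[1, 1, 0]]

theorem affineIndependent_regularTetrahedron : AffineIndependent ℝ regularTetrahedron := by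
  rw [affineIndependent_iff_linearIndependent_succ_sub]
  have det_ne_zero : (!![0, 1, 1; 1, 0, 1; 1, 1, 0] : Matrix (Fin 3) (Fin 3) ℝ).det ≠ 0 := by
    simp [det_fin_three]
  refine .of_comp (WithLp.linearEquiv 2 ℝ (Fin 3 → ℝ)).toLinearMap ?_
  have rows_eq : ((WithLp.linearEquiv 2 ℝ (Fin 3 → ℝ)).toLinearMap ∘
      fun i : Fin 3 ↦ regularTetrahedron i.succ - regularTetrahedron 0) =
      (!![0, 1, 1; 1, 0, 1; 1, 1, 0] : Matrix (Fin 3) (Fin 3) ℝ).row := by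
    ext i j
    fin_cases i <;> simp [regularTetrahedron]
  rw [rows_eq]
  exact linearIndependent_rows_of_det_ne_zero det_ne_zero

theorem dist_regularTetrahedron_le (i j : Fin 4) :
    dist (regularTetrahedron i) (regularTetrahedron j) ≤ √2 := by
  refine Real.le_sqrt_of_sq_le ?_
  rw [dist_sq_eq_dotProduct, vec3_dotProduct]
  fin_cases i <;> fin_cases j <;> simp [regularTetrahedron] <;> norm_num

theorem exists_linearEquiv_le_volume_real_convexHull_range {v : Fin 4 → EuclideanSpace ℝ (Fin 3)}
    (hv : AffineIndependent ℝ v) :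
    ∃ T : EuclideanSpace ℝ (Fin 3) ≃ₗ[ℝ] EuclideanSpace ℝ (Fin 3),
      √2 / 12 * Metric.diam (convexHull ℝ (Set.range fun i ↦ T (v i))) ^ 3 ≤
        volume.real (convexHull ℝ (Set.range fun i ↦ T (v i))) := by
  obtain ⟨T, hT⟩ := exists_linearEquiv_apply_sub finrank_euclideanSpace_fin hv
    affineIndependent_regularTetrahedron
  refine ⟨T, ?_⟩
  have edge_eq (i) : T (v i) - T (v 0) = regularTetrahedron i := by
    rw [← map_sub, hT]
    simp [regularTetrahedron]
  have volume_eq : volume.real (convexHull ℝ (Set.range fun i ↦ T (v i))) = 2 / 6 := by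
    rw [volume_real_convexHull_range_fin_four]
    simp only [edge_eq, regularTetrahedron, cross_apply, vec3_dotProduct, cons_val]
    norm_num
  have diam_le : Metric.diam (convexHull ℝ (Set.range fun i ↦ T (v i))) ≤ √2 := by
    rw [convexHull_diam]
    refine Metric.diam_le_of_forall_dist_le (Real.sqrt_nonneg 2) ?_
    rintro _ ⟨i, rfl⟩ _ ⟨j, rfl⟩
    rw [← dist_sub_right _ _ (T (v 0)), edge_eq, edge_eq]
    exact dist_regularTetrahedron_le i j
  calc √2 / 12 * Metric.diam (convexHull ℝ (Set.range fun i ↦ T (v i))) ^ 3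
      ≤ √2 / 12 * √2 ^ 3 := by gcongr
    _ = (√2 ^ 2) ^ 2 / 12 := by ring
    _ = volume.real (convexHull ℝ (Set.range fun i ↦ T (v i))) := by
        rw [Real.sq_sqrt zero_le_two, volume_eq]
        norm_num

end RegularTetrahedron

theorem image_convexHull_range {k E F ι : Type*} [Field k] [PartialOrder k]
    [AddCommGroup E] [Module k E] [AddCommGroup F] [Module k F] (T : E →ₗ[k] F) (v : ι → E) :
    T '' convexHull k (Set.range v) = convexHull k (Set.range fun i ↦ T (v i)) := by
  rw [T.image_convexHull, ← Set.range_comp]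
  rfl

theorem theorem1 :
    (∀ K : Set (EuclideanSpace ℝ (Fin 3)), IsConvexBody3 K →
      ∃ T : EuclideanSpace ℝ (Fin 3) ≃ₗ[ℝ] EuclideanSpace ℝ (Fin 3),
        MeasureTheory.volume.real (T '' K) ≥ Real.sqrt 2 / 12 * Metric.diam (T '' K) ^ 3) ∧
    (∀ v : Fin 4 → EuclideanSpace ℝ (Fin 3), AffineIndependent ℝ v →
      (∃ T : EuclideanSpace ℝ (Fin 3) ≃ₗ[ℝ] EuclideanSpace ℝ (Fin 3),
        MeasureTheory.volume.real (T '' convexHull ℝ (Set.range v)) =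
          Real.sqrt 2 / 12 * Metric.diam (T '' convexHull ℝ (Set.range v)) ^ 3) ∧
      (∀ T : EuclideanSpace ℝ (Fin 3) ≃ₗ[ℝ] EuclideanSpace ℝ (Fin 3),
        MeasureTheory.volume.real (T '' convexHull ℝ (Set.range v)) ≤
          Real.sqrt 2 / 12 * Metric.diam (T '' convexHull ℝ (Set.range v)) ^ 3)) := by
  refine ⟨fun K hK ↦ exists_linearEquiv_sqrt_two_div_twelve_mul_diam_le hK, fun v hv ↦ ?_⟩
  have image_eq (T : EuclideanSpace ℝ (Fin 3) ≃ₗ[ℝ] EuclideanSpace ℝ (Fin 3)) :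
      T '' convexHull ℝ (Set.range v) = convexHull ℝ (Set.range fun i ↦ T (v i)) :=
    image_convexHull_range T.toLinearMap v
  simp only [image_eq]
  obtain ⟨T, hT⟩ := exists_linearEquiv_le_volume_real_convexHull_range hv
  exact ⟨⟨T, (volume_real_convexHull_range_le _).antisymm hT⟩,
    fun T ↦ volume_real_convexHull_range_le _⟩
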